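/- Let $p$ be a prime, $n\in\mathbb N=\{1,2,\dots\}$, let $E$ be a sequentially complete Hausdorff locally convex topological vector space over $\mathbb Q_p$ (i.e. the open $\mathbb Z_p$-submodules of $E$ form a basis of $0$-neighbourhoods, and every Cauchy sequence in $E$ converges), and let $f\colon U\to E$ be a function on a relatively open subset $U\subseteq\mathbb Z_p^n\subseteq\mathbb Q_p^n$. Let $k\in\mathbb N_0$. Then $f$ is $C^k$ if and only if $f$ is $C^{k e_i}$ for each $i\in\{1,\dots,n\}$, i.e. if and only if $f$ is $C^{(k,0,\dots,0)}$, $C^{(0,k,0,\dots,0)}$, $\dots$, and $C^{(0,\dots,0,k)}$. Here the following definitions are used. A subset $V\subseteq\mathbb Q_p^n$ is *cartesian* if $V=V_1\times\cdots\times V_n$ with subsets $V_i\subseteq\mathbb Q_p$ without isolated points. For $\beta\in\mathbb N_0^n$, write the elements of $\mathbb Q_p^{n+|\beta|}$ as $x=(x^{(1)},\dots,x^{(n)})$ with $x^{(i)}=(x^{(i)}_0,\dots,x^{(i)}_{\beta_i})$. Let $V^{<\beta>}$ be the set of all $x$ such that $(x^{(1)}_{j_1},\dots,x^{(n)}_{j_n})\in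 V$ for all $j_i\in\{0,\dots,\beta_i\}$, and let $V^{>\beta<}$ be the set of all $x\in V^{<\beta>}$ such that for each $i$ the entries $x^{(i)}_0,\dots,x^{(i)}_{\beta_i}$ are pairwise distinct. For $x\in V^{>\beta<}$ let $$f^{>\beta<}(x)=\sum_{j_1=0}^{\beta_1}\cdots\sum_{j_n=0}^{\beta_n}\Bigl(\prod_{i=1}^n\ \prod_{k_i\ne j_i}\frac1{x^{(i)}_{j_i}-x^{(i)}_{k_i}}\Bigr)f(x^{(1)}_{j_1},\dots,x^{(n)}_{j_n}),$$ where $k_i$ ranges over $\{0,\dots,\beta_i\}\setminus\{j_i\}$. For $\alpha\in\mathbb N_0^n$, the function $f$ is $C^\alpha$ if for each cartesian relatively open subset $V\subseteq U$ and each $\beta\in\mathbb N_0^n$ with $\beta\le\alpha$ (componentwise), the map $f^{>\beta<}\colon V^{>\beta<}\to E$ has a continuous extension to $V^{<\beta>}$. For $r\in\mathbb N_0$, $f$ is $C^r$ if it is $C^\alpha$ for all $\alpha\in\mathbb N_0^n$ with $|\alpha|=\alpha_1+\cdots+\alpha_n\le r$. -/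

import Mathlib

open Set Filter Topology

/-- The 0-neighbourhoods of `E` have a basis consisting of the open `𝕆`-submodules of `E`,
where `𝕆 = {a ∈ 𝕜 : ‖a‖ ≤ 1}` is the valuation ring of the ultrametric field `𝕜`. -/
def IsUltrametricLocallyConvex (𝕜 E : Type*) [NormedField 𝕜] [AddCommGroup E] [Module 𝕜 E]
    [TopologicalSpace E] : Prop :=
  (𝓝 (0 : E)).HasBasis
    (fun S : AddSubgroup E =>
      IsOpen (S : Set E) ∧ ∀ a : 𝕜, ‖a‖ ≤ 1 → ∀ x ∈ S, a • x ∈ S)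
    (fun S => (S : Set E))

/-- Every Cauchy sequence converges. -/
def IsSequentiallyComplete (E : Type*) [UniformSpace E] : Prop :=
  ∀ u : ℕ → E, CauchySeq u → ∃ a : E, Tendsto u atTop (𝓝 a)

section CAlpha

variable {𝕜 E : Type*} [Field 𝕜] [TopologicalSpace 𝕜]
  [AddCommGroup E] [Module 𝕜 E] [TopologicalSpace E] {n : ℕ}

/-- A product `V₁ × ⋯ × Vₙ` of subsets of `𝕜` without isolated points. -/
def IsCartesianSet (V : Set (Fin n → 𝕜)) : Prop :=
  ∃ S : Fin n → Set 𝕜, (∀ i, Preperfect (S i)) ∧ V = Set.univ.pi S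

/-- The set `V^{<β>}` of all `x ∈ 𝕜^{n + |β|}`, written as families `x i j` with `i < n` and
`j ∈ {0, …, β i}`, such that `(x 1 (j 1), …, x n (j n)) ∈ V` for every choice of indices `j`. -/
def dqDomain (V : Set (Fin n → 𝕜)) (β : Fin n → ℕ) : Set ((i : Fin n) → Fin (β i + 1) → 𝕜) :=
  {x | ∀ j : (i : Fin n) → Fin (β i + 1), (fun i => x i (j i)) ∈ V}

/-- The set `V^{>β<}` of all `x ∈ V^{<β>}` with `x i j ≠ x i k` for all `i` and all `j ≠ k`. -/
def dqDomainOff (V : Set (Fin n → 𝕜)) (β : Fin n → ℕ) :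
    Set ((i : Fin n) → Fin (β i + 1) → 𝕜) :=
  {x | x ∈ dqDomain V β ∧ ∀ i, ∀ j k : Fin (β i + 1), j ≠ k → x i j ≠ x i k}

/-- The iterated partial difference quotient
`f^{>β<}(x) = ∑_j (∏_i ∏_{k ≠ j i} (x i (j i) - x i k)⁻¹) • f (x 1 (j 1), …, x n (j n))`,
meaningful for `x ∈ V^{>β<}`. -/
def diffQuot (f : (Fin n → 𝕜) → E) (β : Fin n → ℕ)
    (x : (i : Fin n) → Fin (β i + 1) → 𝕜) : E :=
  ∑ j : (i : Fin n) → Fin (β i + 1),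
    (∏ i, ∏ k ∈ Finset.univ.erase (j i), (x i (j i) - x i k)⁻¹) • f (fun i => x i (j i))

/-- `f` is `C^α` on the cartesian set `V`: for every `β ≤ α`, the map `f^{>β<}` on `V^{>β<}` has a
continuous extension to `V^{<β>}`. Only the values of `f` on `V` matter. -/
def IsCAlphaOnCartesian (α : Fin n → ℕ) (f : (Fin n → 𝕜) → E) (V : Set (Fin n → 𝕜)) : Prop :=
  ∀ β : Fin n → ℕ, β ≤ α →
    ∃ g : ((i : Fin n) → Fin (β i + 1) → 𝕜) → E,
      ContinuousOn g (dqDomain V β) ∧ EqOn g (diffQuot f β) (dqDomainOff V β)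

/-- `f` is `C^α` on the (open, or more generally locally cartesian) set `U`: it is `C^α` on each
cartesian relatively open subset of `U`. Only the values of `f` on `U` matter. -/
def IsCAlphaOn (α : Fin n → ℕ) (f : (Fin n → 𝕜) → E) (U : Set (Fin n → 𝕜)) : Prop :=
  ∀ V : Set (Fin n → 𝕜), IsCartesianSet V →
    (∃ W : Set (Fin n → 𝕜), IsOpen W ∧ V = U ∩ W) → IsCAlphaOnCartesian α f V

/-- `f` is `C^r` on the (open, or more generally locally cartesian) set `U`: it is `C^α` for all
multi-indices `α` with `|α| ≤ r`. -/
def IsCROn (r : ℕ) (f : (Fin n → 𝕜) → E) (U : Set (Fin n → 𝕜)) : Prop :=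
  ∀ α : Fin n → ℕ, ∑ i, α i ≤ r → IsCAlphaOn α f U

end CAlpha

/-! If `f` is $C^{ke_i}$ for every `i`, it is approximated very well by interpolation. Near a point,
replace `f` by its restriction to a compact union of small boxes, extended by zero. Let $f_m$
interpolate it on each box of radius $p^{-m}$ in $\mathbb Z_p^n$ by a polynomial of degree at most
$k$ in each variable.

In one direction, the Lagrange error is a product of $k$ factors of size at most $p^{-m}$ times a
difference of two divided differences of order $k$ at nearby nodes (`sub_lagrange_eq`). These extend
continuously to a compact set, so uniform continuity makes the error $o(p^{-mk})$. Changing one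
direction at a time gives $f-f_m=o(p^{-mk})$ (`interpConverges_indicator`).

Conversely, difference quotients of order $|\beta|\le k$ of the basis functions of level $m$ are
$O(p^{mk})$ (`norm_divDiff_ballPoly_le`). Since $f_{m+1}-f_m$ is its own interpolant of level $m+1$
(`interp_interp`), its difference quotients tend to zero uniformly
(`InterpConverges.diffQuot_sub_mem`). In the ultrametric setting this already makes the continuously
extended quotients of $f_m$ uniformly Cauchy, and their limit extends $f^{>\beta<}$. -/

/-! ### Algebra of divided differences in one variable. -/

section DivDiff

variable {𝕜 E : Type*} [Field 𝕜] [AddCommGroup E] [Module 𝕜 E]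

/-- The weight of `F (y j)` in the divided difference of `F` at the points `y`. -/
def ddWeight {b : ℕ} (y : Fin (b + 1) → 𝕜) (j : Fin (b + 1)) : 𝕜 :=
  ∏ k ∈ Finset.univ.erase j, (y j - y k)⁻¹

/-- The divided difference of `F` at the points `y 0, …, y b`. -/
def divDiff (F : 𝕜 → E) {b : ℕ} (y : Fin (b + 1) → 𝕜) : E :=
  ∑ j, ddWeight y j • F (y j)

theorem ddWeight_eq_prod_ite {b : ℕ} (y : Fin (b + 1) → 𝕜) (j : Fin (b + 1)) :
    ddWeight y j = ∏ k, if k = j then 1 else (y j - y k)⁻¹ := by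
  rw [ddWeight, ← Finset.prod_erase Finset.univ (a := j)
    (f := fun k => if k = j then 1 else (y j - y k)⁻¹) (by simp)]
  exact Finset.prod_congr rfl fun k hk => by simp [Finset.ne_of_mem_erase hk]

theorem ddWeight_succAbove {b : ℕ} (y : Fin (b + 2) → 𝕜) (hy : Function.Injective y)
    (j : Fin (b + 2)) (l : Fin (b + 1)) :
    ddWeight (y ∘ j.succAbove) l = ddWeight y (j.succAbove l) * (y (j.succAbove l) - y j) := by
  rw [ddWeight_eq_prod_ite, ddWeight_eq_prod_ite, Fin.prod_univ_succAbove _ j]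
  have h : y (j.succAbove l) - y j ≠ 0 := sub_ne_zero.2 (hy.ne (Fin.succAbove_ne j l))
  simp only [(Fin.succAbove_ne j l).symm, if_false, Fin.succAbove_right_inj, Function.comp]
  field_simp

/-- The factor $x-y_j$ kills the term at $y_j$ and cancels one factor in every other weight.
Identities between divided differences on different node sets thereby become pointwise identities
between functions. -/
theorem divDiff_comp_succAbove (F : 𝕜 → E) {b : ℕ} (y : Fin (b + 2) → 𝕜)
    (hy : Function.Injective y) (j : Fin (b + 2)) :
    divDiff F (y ∘ j.succAbove) = divDiff (fun x => (x - y j) • F x) y := by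
  rw [divDiff, divDiff, Fin.sum_univ_succAbove _ j]
  simp only [sub_self, zero_smul, smul_zero, zero_add, ddWeight_succAbove y hy, mul_smul,
    Function.comp]

theorem divDiff_add (F G : 𝕜 → E) {b : ℕ} (y : Fin (b + 1) → 𝕜) :
    divDiff (fun x => F x + G x) y = divDiff F y + divDiff G y := by
  simp [divDiff, Finset.sum_add_distrib]

theorem divDiff_sub (F G : 𝕜 → E) {b : ℕ} (y : Fin (b + 1) → 𝕜) :
    divDiff (fun x => F x - G x) y = divDiff F y - divDiff G y := by
  simp [divDiff, Finset.sum_sub_distrib, smul_sub]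

theorem divDiff_const_smul (c : 𝕜) (F : 𝕜 → E) {b : ℕ} (y : Fin (b + 1) → 𝕜) :
    divDiff (fun x => c • F x) y = c • divDiff F y := by
  simp [divDiff, Finset.smul_sum, smul_comm c]

theorem divDiff_sum {ι : Type*} (s : Finset ι) (F : ι → 𝕜 → E) {b : ℕ} (y : Fin (b + 1) → 𝕜) :
    divDiff (fun x => ∑ i ∈ s, F i x) y = ∑ i ∈ s, divDiff (F i) y := by
  simp only [divDiff, Finset.smul_sum]
  exact Finset.sum_comm

theorem divDiff_zero_index (F : 𝕜 → E) (y : Fin (0 + 1) → 𝕜) : divDiff F y = F (y 0) := by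
  simp [divDiff, ddWeight]

theorem divDiff_congr {F G : 𝕜 → E} {b : ℕ} {y : Fin (b + 1) → 𝕜}
    (h : ∀ j, F (y j) = G (y j)) : divDiff F y = divDiff G y := by
  simp [divDiff, h]

theorem smul_divDiff_succ (F : 𝕜 → E) {b : ℕ} (y : Fin (b + 2) → 𝕜)
    (hy : Function.Injective y) (i j : Fin (b + 2)) :
    (y i - y j) • divDiff F y = divDiff F (y ∘ j.succAbove) - divDiff F (y ∘ i.succAbove) := by
  rw [divDiff_comp_succAbove F y hy, divDiff_comp_succAbove F y hy, ← divDiff_sub,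
    ← divDiff_const_smul]
  refine divDiff_congr fun l => ?_
  rw [← sub_smul]
  congr 1
  ring

theorem divDiff_succ (F : 𝕜 → E) {b : ℕ} (y : Fin (b + 2) → 𝕜)
    (hy : Function.Injective y) {i j : Fin (b + 2)} (hij : i ≠ j) :
    divDiff F y =
      (y i - y j)⁻¹ • (divDiff F (y ∘ j.succAbove) - divDiff F (y ∘ i.succAbove)) := by
  rw [← smul_divDiff_succ F y hy, smul_smul, inv_mul_cancel₀ (sub_ne_zero.2 (hy.ne hij)), one_smul]

/-- Leibniz rule for the factor $x=y_0+(x-y_0)$. -/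
theorem divDiff_smul_id (F : 𝕜 → E) {b : ℕ} (y : Fin (b + 2) → 𝕜)
    (hy : Function.Injective y) :
    divDiff (fun x => x • F x) y = y 0 • divDiff F y + divDiff F (y ∘ Fin.succ) := by
  have h := divDiff_comp_succAbove F y hy 0
  rw [Fin.succAbove_zero] at h
  rw [h, ← divDiff_const_smul, ← divDiff_add]
  refine divDiff_congr fun l => ?_
  rw [← add_smul]
  congr 1
  ring

theorem divDiff_one (b : ℕ) (y : Fin (b + 1) → 𝕜) (hy : Function.Injective y) :
    divDiff (fun _ => (1 : 𝕜)) y = if b = 0 then 1 else 0 := by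
  induction b with
  | zero => simp [divDiff_zero_index]
  | succ b ih =>
    rw [divDiff_succ _ y hy (i := 0) (j := Fin.last _) (by simp [Fin.ext_iff]),
      ih _ (hy.comp Fin.succAbove_right_injective), ih _ (hy.comp Fin.succAbove_right_injective)]
    simp

theorem divDiff_comp_affine (F : 𝕜 → E) (a : 𝕜) {c : 𝕜} (hc : c ≠ 0) {b : ℕ}
    (y : Fin (b + 1) → 𝕜) :
    divDiff (fun x => F ((x - a) / c)) y = (c⁻¹) ^ b • divDiff F (fun j => (y j - a) / c) := by
  simp only [divDiff, Finset.smul_sum, smul_smul]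
  refine Finset.sum_congr rfl fun j _ => ?_
  congr 1
  rw [ddWeight, ddWeight]
  have : (c⁻¹ : 𝕜) ^ b = ∏ k ∈ Finset.univ.erase j, c⁻¹ := by
    simp [Finset.card_erase_of_mem]
  rw [this, ← Finset.prod_mul_distrib]
  refine Finset.prod_congr rfl fun k _ => ?_
  rw [div_sub_div_same, sub_sub_sub_cancel_right, inv_div]
  field_simp

/-- The error of Lagrange interpolation, as a divided difference. -/
theorem prod_smul_divDiff_cons (F : 𝕜 → E) {b : ℕ} (x : 𝕜) (t : Fin (b + 1) → 𝕜)
    (h : Function.Injective (Fin.cons x t : Fin (b + 2) → 𝕜)) :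
    (∏ l, (x - t l)) • divDiff F (Fin.cons x t : Fin (b + 2) → 𝕜) =
      F x - ∑ j, (∏ l ∈ Finset.univ.erase j, (x - t l) / (t j - t l)) • F (t j) := by
  have hx : ∀ j, x - t j ≠ 0 := fun j =>
    sub_ne_zero.2 (by simpa using h.ne (Fin.succ_ne_zero j).symm)
  rw [divDiff, Fin.sum_univ_succ, smul_add, Finset.smul_sum, sub_eq_add_neg,
    ← Finset.sum_neg_distrib]
  congr 1
  · rw [smul_smul, ddWeight_eq_prod_ite, Fin.prod_univ_succ (n := b + 1)]
    simp only [Fin.succ_ne_zero, if_true, if_false, one_mul, Fin.cons_zero, Fin.cons_succ]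
    rw [← Finset.prod_mul_distrib, Finset.prod_eq_one (fun l _ => mul_inv_cancel₀ (hx l)),
      one_smul]
  · refine Finset.sum_congr rfl fun j _ => ?_
    rw [smul_smul, ← neg_smul, Fin.cons_succ]
    congr 1
    rw [ddWeight_eq_prod_ite, Fin.prod_univ_succ (n := b + 1)]
    simp only [(Fin.succ_ne_zero j).symm, if_false, Fin.cons_zero, Fin.cons_succ, Fin.succ_inj]
    rw [← ddWeight_eq_prod_ite, ddWeight, ← Finset.mul_prod_erase _ _ (Finset.mem_univ j)]
    simp only [div_eq_mul_inv, Finset.prod_mul_distrib]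
    have := hx j
    have h2 : t j - x ≠ 0 := by rwa [← neg_sub, neg_ne_zero]
    have h3 : (x - t j) * (t j - x)⁻¹ = -1 := by
      rw [← neg_sub (t j) x, neg_mul, mul_inv_cancel₀ h2]
    linear_combination (∏ l ∈ Finset.univ.erase j, (x - t l)) *
      (∏ l ∈ Finset.univ.erase j, (t j - t l)⁻¹) * h3

/-- The error of Lagrange interpolation at `t 0, …, t b`, as a difference of two divided
differences of order `b`. -/
theorem sub_lagrange_eq (F : 𝕜 → E) {b : ℕ} (x : 𝕜) (t : Fin (b + 1) → 𝕜)
    (h : Function.Injective (Fin.cons x t : Fin (b + 2) → 𝕜)) :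
    F x - ∑ j, (∏ l ∈ Finset.univ.erase j, (x - t l) / (t j - t l)) • F (t j) =
      (∏ l : Fin b, (x - t l.castSucc)) •
        (divDiff F ((Fin.cons x t : Fin (b + 2) → 𝕜) ∘ (Fin.last _).succAbove) - divDiff F t) := by
  rw [← prod_smul_divDiff_cons F x t h, Fin.prod_univ_castSucc, mul_smul]
  -- The last factor $x-t_b$ is the difference of two nodes of `Fin.cons x t`; spending it lowers
  -- the order from $b+1$ to $b$, the highest order that the hypotheses control.
  have := smul_divDiff_succ F _ h 0 (Fin.last _)
  rw [show (Fin.last (b + 1)) = (Fin.last b).succ from rfl, Fin.cons_zero, Fin.cons_succ] at this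
  rw [this]
  rfl

end DivDiff

/-! ### Divided differences of locally polynomial functions: bounds and continuous extension. -/

section Continuity

variable {𝕜 : Type*} [NontriviallyNormedField 𝕜]

/-- Coinciding entries are separated by the distinct multiples of `t`, and distinct entries stay
distinct for small `t`. -/
theorem eventually_injective_add_mul [CharZero 𝕜] {b : ℕ} (y : Fin (b + 1) → 𝕜) :
    ∀ᶠ t in 𝓝[≠] (0 : 𝕜), Function.Injective fun j => y j + t * ((j : ℕ) : 𝕜) := by
  have key : ∀ i j : Fin (b + 1), i ≠ j →
      ∀ᶠ t in 𝓝[≠] (0 : 𝕜), y i + t * ((i : ℕ) : 𝕜) ≠ y j + t * ((j : ℕ) : 𝕜) := by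
    intro i j hij
    have hij' : ((i : ℕ) : 𝕜) - ((j : ℕ) : 𝕜) ≠ 0 := by
      rw [sub_ne_zero, Ne, Nat.cast_inj]
      exact fun h => hij (Fin.ext h)
    by_cases hy : y i = y j
    · filter_upwards [self_mem_nhdsWithin] with t ht h
      rw [hy, add_right_inj] at h
      exact hij' (sub_eq_zero.2 (mul_left_cancel₀ ht h))
    · have : ContinuousAt (fun t : 𝕜 => (y i + t * ((i : ℕ) : 𝕜)) - (y j + t * ((j : ℕ) : 𝕜))) 0 := by
        fun_prop
      have h0 := this.eventually_ne (y := 0) (by simpa [sub_eq_zero] using hy)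
      filter_upwards [nhdsWithin_le_nhds h0] with t ht h
      exact ht (sub_eq_zero.2 h)
  have := eventually_all.2 fun i => eventually_all.2 fun j => eventually_imp_distrib_left.2 (key i j)
  filter_upwards [this] with t ht i j h
  by_contra hij
  exact ht i j hij h

theorem tendsto_add_mul {n : ℕ} {β : Fin n → ℕ} (y : (i : Fin n) → Fin (β i + 1) → 𝕜) :
    Tendsto (fun (t : 𝕜) i j => y i j + t * ((j : ℕ) : 𝕜)) (𝓝[≠] (0 : 𝕜)) (𝓝 y) := by
  have : Continuous fun (t : 𝕜) i j => y i j + t * ((j : ℕ) : 𝕜) := by fun_prop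
  simpa using (this.tendsto 0).mono_left nhdsWithin_le_nhds

/-- Families of tuples of pairwise distinct entries are dense. -/
theorem dense_setOf_forall_injective [CharZero 𝕜] {n : ℕ} (β : Fin n → ℕ) :
    Dense {x : (i : Fin n) → Fin (β i + 1) → 𝕜 | ∀ i, Function.Injective (x i)} := fun y =>
  mem_closure_of_tendsto (tendsto_add_mul y)
    (eventually_all.2 fun i => eventually_injective_add_mul (y i))

theorem dense_setOf_injective [CharZero 𝕜] (b : ℕ) :
    Dense {y : Fin (b + 1) → 𝕜 | Function.Injective y} := fun y => by
  have : Continuous fun (t : 𝕜) j => y j + t * ((j : ℕ) : 𝕜) := by fun_prop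
  exact mem_closure_of_tendsto (b := 𝓝[≠] (0 : 𝕜))
    (by simpa using (this.tendsto 0).mono_left nhdsWithin_le_nhds)
    (eventually_injective_add_mul y)

open Classical in
/-- The function with value `q ((x - a) / c)` on the ball `‖x - a‖ ≤ ‖c‖`, and `0` elsewhere. -/
noncomputable def ballPoly (a c : 𝕜) (q : Polynomial 𝕜) (x : 𝕜) : 𝕜 :=
  if ‖x - a‖ ≤ ‖c‖ then q.eval ((x - a) / c) else 0

theorem ballPoly_of_mem {a c x : 𝕜} (q : Polynomial 𝕜) (h : ‖x - a‖ ≤ ‖c‖) :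
    ballPoly a c q x = q.eval ((x - a) / c) := if_pos h

theorem ballPoly_of_notMem {a c x : 𝕜} (q : Polynomial 𝕜) (h : ¬ ‖x - a‖ ≤ ‖c‖) :
    ballPoly a c q x = 0 := if_neg h

variable [IsUltrametricDist 𝕜]

theorem norm_sub_le_of_ultra {x y : 𝕜} {r : ℝ} (hx : ‖x‖ ≤ r) (hy : ‖y‖ ≤ r) : ‖x - y‖ ≤ r := by
  rw [sub_eq_add_neg]
  exact (IsUltrametricDist.norm_add_le_max _ _).trans (max_le hx (by rwa [norm_neg]))

theorem norm_add_le_of_ultra {x y : 𝕜} {r : ℝ} (hx : ‖x‖ ≤ r) (hy : ‖y‖ ≤ r) : ‖x + y‖ ≤ r :=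
  (IsUltrametricDist.norm_add_le_max _ _).trans (max_le hx hy)

/-- The Leibniz rule builds `G` by additions and multiplications by entries alone, so it is
continuous and, by the ultrametric inequality, bounded by 1 on the unit polydisc. -/
theorem exists_continuous_divDiff_pow (d b : ℕ) :
    ∃ G : (Fin (b + 1) → 𝕜) → 𝕜, Continuous G ∧
      (∀ y, Function.Injective y → divDiff (fun x : 𝕜 => x ^ d) y = G y) ∧
      ∀ y, (∀ i, ‖y i‖ ≤ 1) → ‖G y‖ ≤ 1 := by
  induction d generalizing b with
  | zero =>
    refine ⟨fun _ => if b = 0 then 1 else 0, continuous_const, fun y hy => ?_, fun y _ => ?_⟩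
    · simpa using divDiff_one b y hy
    · split_ifs <;> simp
  | succ d ih =>
    cases b with
    | zero =>
      refine ⟨fun y => y 0 ^ (d + 1), by fun_prop, fun y _ => divDiff_zero_index _ _, fun y hy => ?_⟩
      rw [norm_pow]
      exact pow_le_one₀ (norm_nonneg _) (hy 0)
    | succ b =>
      obtain ⟨G, hGc, hG, hG1⟩ := ih (b + 1)
      obtain ⟨H, hHc, hH, hH1⟩ := ih b
      refine ⟨fun y => y 0 * G y + H (y ∘ Fin.succ), ?_, fun y hy => ?_, fun y hy => ?_⟩
      · have : Continuous fun y : Fin (b + 2) → 𝕜 => y ∘ Fin.succ := by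
          unfold Function.comp; fun_prop
        fun_prop
      · dsimp only
        rw [← hG y hy, ← hH _ (hy.comp (Fin.succ_injective _))]
        simpa [pow_succ'] using divDiff_smul_id (fun x : 𝕜 => x ^ d) y hy
      · refine norm_add_le_of_ultra ?_ (hH1 _ fun i => hy _)
        rw [norm_mul]
        exact mul_le_one₀ (hy 0) (norm_nonneg _) (hG1 y hy)

theorem exists_continuous_divDiff_eval (q : Polynomial 𝕜) {R : ℝ} (hR : ∀ d, ‖q.coeff d‖ ≤ R)
    (b : ℕ) :
    ∃ G : (Fin (b + 1) → 𝕜) → 𝕜, Continuous G ∧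
      (∀ y, Function.Injective y → divDiff (fun x : 𝕜 => q.eval x) y = G y) ∧
      ∀ y, (∀ i, ‖y i‖ ≤ 1) → ‖G y‖ ≤ R := by
  choose G hGc hG hG1 using fun d => exists_continuous_divDiff_pow (𝕜 := 𝕜) d b
  have hR0 : 0 ≤ R := (norm_nonneg _).trans (hR 0)
  refine ⟨fun y => ∑ d ∈ Finset.range (q.natDegree + 1), q.coeff d * G d y, by fun_prop,
    fun y hy => ?_, fun y hy => ?_⟩
  · simp only [Polynomial.eval_eq_sum_range, divDiff_sum]
    refine Finset.sum_congr rfl fun d _ => ?_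
    rw [← hG d y hy]
    exact divDiff_const_smul (q.coeff d) (fun x : 𝕜 => x ^ d) y
  · refine IsUltrametricDist.norm_sum_le_of_forall_le_of_nonneg hR0 fun d _ => ?_
    rw [norm_mul]
    exact (mul_le_mul (hR d) (hG1 d y hy) (norm_nonneg _) hR0).trans (mul_one R).le

/-- Balls of equal radius coincide or are disjoint: the nodes all lie in the ball, where the
function is a rescaled polynomial, or all outside, where it vanishes. -/
theorem norm_divDiff_ballPoly_of_close (a : 𝕜) {c : 𝕜} (hc : c ≠ 0) (q : Polynomial 𝕜) {R : ℝ}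
    (hR : ∀ d, ‖q.coeff d‖ ≤ R) {b : ℕ} {y : Fin (b + 1) → 𝕜} (hy : Function.Injective y)
    (hclose : ∀ i, ‖y i - y 0‖ ≤ ‖c‖) :
    ‖divDiff (ballPoly a c q) y‖ ≤ R * ‖c⁻¹‖ ^ b := by
  have hR0 : 0 ≤ R := (norm_nonneg _).trans (hR 0)
  by_cases h0 : ‖y 0 - a‖ ≤ ‖c‖
  · have hb : ∀ i, ‖y i - a‖ ≤ ‖c‖ := fun i => by
      simpa using norm_add_le_of_ultra (hclose i) h0
    rw [divDiff_congr (G := fun x => q.eval ((x - a) / c)) fun i => ballPoly_of_mem q (hb i),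
      divDiff_comp_affine (fun x => q.eval x) a hc]
    obtain ⟨G, -, hG, hG1⟩ := exists_continuous_divDiff_eval q hR b
    rw [hG, smul_eq_mul, norm_mul, norm_pow, mul_comm]
    · refine mul_le_mul_of_nonneg_right (hG1 _ fun i => ?_) (by positivity)
      rw [norm_div]
      exact div_le_one_of_le₀ (hb i) (norm_nonneg _)
    · intro i j hij
      exact hy (by simpa [div_left_inj' hc] using hij)
  · rw [divDiff_congr (G := fun _ => 0)]
    · simp only [divDiff, smul_zero, Finset.sum_const_zero, norm_zero]
      positivity
    · refine fun i => ballPoly_of_notMem q fun hi => h0 ?_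
      simpa using norm_sub_le_of_ultra hi (hclose i)

/-- An inverse inequality of Bernstein type. If two nodes are more than `‖c‖` apart, the recursion
through them divides by more than `‖c‖`, so each order costs at most one factor `‖c⁻¹‖`. -/
theorem norm_divDiff_ballPoly_le (a : 𝕜) {c : 𝕜} (hc : c ≠ 0) (q : Polynomial 𝕜) {R : ℝ}
    (hR : ∀ d, ‖q.coeff d‖ ≤ R) {b : ℕ} {y : Fin (b + 1) → 𝕜} (hy : Function.Injective y) :
    ‖divDiff (ballPoly a c q) y‖ ≤ R * ‖c⁻¹‖ ^ b := by
  have hR0 : 0 ≤ R := (norm_nonneg _).trans (hR 0)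
  induction b with
  | zero =>
    refine norm_divDiff_ballPoly_of_close a hc q hR hy fun i => ?_
    rw [show i = 0 from Fin.fin_one_eq_zero i, sub_self, norm_zero]
    exact norm_nonneg c
  | succ b ih =>
    by_cases hclose : ∀ i, ‖y i - y 0‖ ≤ ‖c‖
    · exact norm_divDiff_ballPoly_of_close a hc q hR hy hclose
    push Not at hclose
    obtain ⟨i, hi⟩ := hclose
    have hi0 : i ≠ 0 := by
      rintro rfl
      rw [sub_self, norm_zero] at hi
      exact absurd hi (norm_nonneg c).not_gt
    have IH : ∀ l : Fin (b + 2),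
        ‖divDiff (ballPoly a c q) (y ∘ l.succAbove)‖ ≤ R * ‖c⁻¹‖ ^ b :=
      fun l => ih (hy.comp Fin.succAbove_right_injective)
    rw [divDiff_succ _ y hy hi0, smul_eq_mul, norm_mul, pow_succ', ← mul_assoc, mul_comm R,
      mul_assoc]
    refine mul_le_mul ?_ (norm_sub_le_of_ultra (IH _) (IH _)) (norm_nonneg _) (norm_nonneg _)
    rw [norm_inv, norm_inv]
    exact inv_anti₀ (norm_pos_iff.2 hc) hi.le

theorem exists_tendsto_divDiff_ballPoly_of_close (a : 𝕜) {c : 𝕜} (hc : c ≠ 0)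
    (q : Polynomial 𝕜) {b : ℕ} (y₀ : Fin (b + 1) → 𝕜) (hclose : ∀ i, ‖y₀ i - y₀ 0‖ ≤ ‖c‖) :
    ∃ l, Tendsto (fun y => divDiff (ballPoly a c q) y) (𝓝[{y | Function.Injective y}] y₀) (𝓝 l) := by
  have hc0 : 0 < ‖c‖ := norm_pos_iff.2 hc
  have hnear : ∀ᶠ y in 𝓝[{y | Function.Injective y}] y₀, ∀ i, ‖y i - y₀ 0‖ ≤ ‖c‖ := by
    refine nhdsWithin_le_nhds (eventually_all.2 fun i => ?_)
    have : ∀ᶠ y : Fin (b + 1) → 𝕜 in 𝓝 y₀, ‖y i - y₀ i‖ < ‖c‖ := by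
      have : ContinuousAt (fun y : Fin (b + 1) → 𝕜 => ‖y i - y₀ i‖) y₀ :=
        ((continuous_apply i).sub continuous_const).norm.continuousAt
      exact this.eventually_lt continuousAt_const (by simpa using hc0)
    filter_upwards [this] with y hy
    simpa using norm_add_le_of_ultra hy.le (hclose i)
  by_cases h0 : ‖y₀ 0 - a‖ ≤ ‖c‖
  · have hR : ∃ R, ∀ d, ‖q.coeff d‖ ≤ R := by
      refine ⟨∑ d ∈ q.support, ‖q.coeff d‖, fun d => ?_⟩
      by_cases hd : d ∈ q.support
      · exact Finset.single_le_sum (f := fun d => ‖q.coeff d‖) (fun _ _ => norm_nonneg _) hd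
      · rw [Polynomial.notMem_support_iff.1 hd, norm_zero]
        exact Finset.sum_nonneg fun _ _ => norm_nonneg _
    obtain ⟨R, hR⟩ := hR
    obtain ⟨G, hGc, hG, -⟩ := exists_continuous_divDiff_eval q hR b
    have hcont : Continuous fun y : Fin (b + 1) → 𝕜 => c⁻¹ ^ b • G fun j => (y j - a) / c := by
      have : Continuous fun (y : Fin (b + 1) → 𝕜) j => (y j - a) / c := by fun_prop
      fun_prop
    refine ⟨_, ((hcont.tendsto y₀).mono_left nhdsWithin_le_nhds).congr' ?_⟩
    filter_upwards [hnear, self_mem_nhdsWithin] with y hy hinj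
    rw [divDiff_congr (G := fun x => q.eval ((x - a) / c)) fun i =>
        ballPoly_of_mem q (by simpa using norm_add_le_of_ultra (hy i) h0),
      divDiff_comp_affine (fun x => q.eval x) a hc, hG]
    intro i j hij
    exact hinj (by simpa [div_left_inj' hc] using hij)
  · refine ⟨0, tendsto_const_nhds.congr' ?_⟩
    filter_upwards [hnear] with y hy
    rw [divDiff_congr (G := fun _ => 0) fun i => ballPoly_of_notMem q fun hi => h0 (by
      simpa using norm_sub_le_of_ultra hi (hy i))]
    simp [divDiff]

/-- The same dichotomy: close nodes reduce to a polynomial or to zero; otherwise two limiting nodes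
differ and the recursion through them is continuous there. -/
theorem exists_tendsto_divDiff_ballPoly (a : 𝕜) {c : 𝕜} (hc : c ≠ 0) (q : Polynomial 𝕜) {b : ℕ}
    (y₀ : Fin (b + 1) → 𝕜) :
    ∃ l, Tendsto (fun y => divDiff (ballPoly a c q) y) (𝓝[{y | Function.Injective y}] y₀) (𝓝 l) := by
  induction b with
  | zero =>
    refine exists_tendsto_divDiff_ballPoly_of_close a hc q y₀ fun i => ?_
    rw [show i = 0 from Fin.fin_one_eq_zero i, sub_self, norm_zero]
    exact norm_nonneg c
  | succ b ih =>
    by_cases hclose : ∀ i, ‖y₀ i - y₀ 0‖ ≤ ‖c‖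
    · exact exists_tendsto_divDiff_ballPoly_of_close a hc q y₀ hclose
    push Not at hclose
    obtain ⟨i, hi⟩ := hclose
    have hne : y₀ i ≠ y₀ 0 := by
      intro h
      rw [h, sub_self, norm_zero] at hi
      exact absurd hi (norm_nonneg c).not_gt
    have hi0 : i ≠ 0 := fun h => hne (h ▸ rfl)
    have IH : ∀ l : Fin (b + 2), ∃ v, Tendsto (fun y => divDiff (ballPoly a c q) (y ∘ l.succAbove))
        (𝓝[{y | Function.Injective y}] y₀) (𝓝 v) := fun l => by
      obtain ⟨v, hv⟩ := ih (y₀ ∘ l.succAbove)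
      refine ⟨v, hv.comp (tendsto_nhdsWithin_iff.2 ⟨?_, ?_⟩)⟩
      · have : Continuous fun y : Fin (b + 2) → 𝕜 => y ∘ l.succAbove := by
          unfold Function.comp; fun_prop
        exact (this.tendsto y₀).mono_left nhdsWithin_le_nhds
      · filter_upwards [self_mem_nhdsWithin] with y hy
        exact Function.Injective.comp hy Fin.succAbove_right_injective
    obtain ⟨v, hv⟩ := IH 0
    obtain ⟨w, hw⟩ := IH i
    have hinv : Tendsto (fun y : Fin (b + 2) → 𝕜 => (y i - y 0)⁻¹)
        (𝓝[{y | Function.Injective y}] y₀) (𝓝 (y₀ i - y₀ 0)⁻¹) := by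
      have : Continuous fun y : Fin (b + 2) → 𝕜 => y i - y 0 := by fun_prop
      exact ((this.tendsto y₀).inv₀ (sub_ne_zero.2 hne)).mono_left nhdsWithin_le_nhds
    refine ⟨_, (hinv.smul (hv.sub hw)).congr' ?_⟩
    filter_upwards [self_mem_nhdsWithin] with y hy
    exact (divDiff_succ _ y hy hi0).symm

theorem exists_continuous_divDiff_ballPoly [CharZero 𝕜] (a : 𝕜) {c : 𝕜} (hc : c ≠ 0)
    (q : Polynomial 𝕜) (b : ℕ) :
    ∃ G : (Fin (b + 1) → 𝕜) → 𝕜, Continuous G ∧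
      ∀ y, Function.Injective y → divDiff (ballPoly a c q) y = G y := by
  refine ⟨extendFrom {y | Function.Injective y} fun y => divDiff (ballPoly a c q) y,
    continuous_extendFrom (dense_setOf_injective b) (exists_tendsto_divDiff_ballPoly a hc q),
    fun y hy => ?_⟩
  obtain ⟨l, hl⟩ := exists_tendsto_divDiff_ballPoly a hc q y
  rw [extendFrom_eq (dense_setOf_injective b y) hl]
  exact tendsto_nhds_unique (tendsto_pure_nhds _ _) (hl.mono_left (pure_le_nhdsWithin hy))

end Continuity

/-! ### Piecewise polynomial interpolation on $\mathbb Z_p^n$. -/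

section Interpolation

/-- On a product of functions of one variable each, the iterated difference quotient factors into
divided differences. -/
theorem diffQuot_sum_prod_smul {𝕜 E ι : Type*} [Field 𝕜] [TopologicalSpace 𝕜]
    [AddCommGroup E] [Module 𝕜 E] [Fintype ι] {n : ℕ} (φ : ι → 𝕜 → 𝕜) (e : (Fin n → ι) → E)
    (β : Fin n → ℕ) (x : (i : Fin n) → Fin (β i + 1) → 𝕜) :
    diffQuot (fun z => ∑ ν : Fin n → ι, (∏ i, φ (ν i) (z i)) • e ν) β x =
      ∑ ν : Fin n → ι, (∏ i, divDiff (φ (ν i)) (x i)) • e ν := by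
  simp only [diffQuot, Finset.smul_sum, smul_smul]
  rw [Finset.sum_comm]
  refine Finset.sum_congr rfl fun ν _ => ?_
  rw [← Finset.sum_smul]
  congr 1
  simp only [divDiff, Fintype.prod_sum, smul_eq_mul, ← Finset.prod_mul_distrib]
  rfl

theorem diffQuot_sub {𝕜 E : Type*} [Field 𝕜] [TopologicalSpace 𝕜]
    [AddCommGroup E] [Module 𝕜 E] {n : ℕ} (f g : (Fin n → 𝕜) → E)
    (β : Fin n → ℕ) (x : (i : Fin n) → Fin (β i + 1) → 𝕜) :
    diffQuot (fun z => f z - g z) β x = diffQuot f β x - diffQuot g β x := by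
  simp only [diffQuot, smul_sub, Finset.sum_sub_distrib]

variable {p : ℕ} [Fact p.Prime] {k : ℕ}

/-- The index set of the interpolation nodes in `ℤ_p` of level `m` and order `k`. -/
abbrev NodeIndex (p k m : ℕ) : Type := Fin (p ^ m) × Fin (k + 1)

/-- The nodes `a + p ^ m * j` with `a < p ^ m` and `j ≤ k`. -/
noncomputable def node {m : ℕ} (ν : NodeIndex p k m) : ℚ_[p] :=
  ((ν.1 : ℕ) : ℚ_[p]) + (p : ℚ_[p]) ^ m * ((ν.2 : ℕ) : ℚ_[p])

variable (p) in
/-- The Lagrange basis polynomials for the nodes `0, …, k`. -/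
noncomputable def lagrangeNat (j : Fin (k + 1)) : Polynomial ℚ_[p] :=
  Lagrange.basis Finset.univ (fun i : Fin (k + 1) => ((i : ℕ) : ℚ_[p])) j

/-- The function equal to a Lagrange basis polynomial on a ball of radius `p ^ (-m)` and to `0`
elsewhere. -/
noncomputable def nodeBasis {m : ℕ} (ν : NodeIndex p k m) : ℚ_[p] → ℚ_[p] :=
  ballPoly ((ν.1 : ℕ) : ℚ_[p]) ((p : ℚ_[p]) ^ m) (lagrangeNat p ν.2)

theorem padic_pow_ne_zero (m : ℕ) : (p : ℚ_[p]) ^ m ≠ 0 :=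
  pow_ne_zero _ (Nat.cast_ne_zero.2 (Fact.out : p.Prime).ne_zero)

theorem padic_norm_pow_le_one (m : ℕ) : ‖(p : ℚ_[p]) ^ m‖ ≤ 1 := by
  rw [norm_pow]
  exact pow_le_one₀ (norm_nonneg _) Padic.norm_p_lt_one.le

theorem padic_norm_pow_le_pow {m m' : ℕ} (h : m' ≤ m) :
    ‖(p : ℚ_[p]) ^ m‖ ≤ ‖(p : ℚ_[p]) ^ m'‖ := by
  rw [norm_pow, norm_pow]
  exact pow_le_pow_of_le_one (norm_nonneg _) Padic.norm_p_lt_one.le h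

theorem exists_norm_sub_natCast_le (m : ℕ) {x : ℚ_[p]} (hx : ‖x‖ ≤ 1) :
    ∃ a : Fin (p ^ m), ‖x - ((a : ℕ) : ℚ_[p])‖ ≤ ‖(p : ℚ_[p]) ^ m‖ := by
  obtain ⟨x, rfl⟩ : ∃ u : ℤ_[p], (u : ℚ_[p]) = x := ⟨⟨x, hx⟩, rfl⟩
  refine ⟨⟨x.appr m, PadicInt.appr_lt _ _⟩, ?_⟩
  have := (PadicInt.norm_le_pow_iff_mem_span_pow _ m).2 (PadicInt.appr_spec m x)
  rw [PadicInt.norm_def, PadicInt.coe_sub, PadicInt.coe_natCast] at this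
  rwa [Padic.norm_p_pow]

theorem norm_natCast_sub_le_iff {m : ℕ} (a a' : Fin (p ^ m)) :
    ‖((a : ℕ) : ℚ_[p]) - ((a' : ℕ) : ℚ_[p])‖ ≤ ‖(p : ℚ_[p]) ^ m‖ ↔ a = a' := by
  constructor
  · intro h
    have h2 : ‖(((a : ℕ) - (a' : ℕ) : ℤ) : ℚ_[p])‖ ≤ (p : ℝ) ^ (-(m : ℤ)) := by
      rw [← Padic.norm_p_pow]
      simpa using h
    rw [Padic.norm_int_le_pow_iff_dvd] at h2
    have h3 : ((a : ℕ) : ℤ) ≡ (a' : ℕ) [ZMOD ((p ^ m : ℕ) : ℤ)] := by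
      refine (Int.modEq_iff_dvd.2 ?_).symm
      exact_mod_cast h2
    have h4 := (Int.natCast_modEq_iff).1 h3
    exact Fin.ext (Nat.ModEq.eq_of_lt_of_lt h4 a.2 a'.2)
  · rintro rfl
    simp

theorem norm_add_pow_mul_sub_le {a z t : ℚ_[p]} (m : ℕ) (hz : ‖z‖ ≤ 1)
    (h : ‖a - t‖ ≤ ‖(p : ℚ_[p]) ^ m‖) : ‖a + (p : ℚ_[p]) ^ m * z - t‖ ≤ ‖(p : ℚ_[p]) ^ m‖ := by
  rw [add_sub_right_comm]
  refine norm_add_le_of_ultra h ?_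
  rw [norm_mul]
  exact mul_le_of_le_one_right (norm_nonneg _) hz

theorem padic_norm_natCast_le_one (j : ℕ) : ‖(j : ℚ_[p])‖ ≤ 1 := by
  simpa using Padic.norm_int_le_one (p := p) (j : ℤ)

theorem norm_node_le_one {m : ℕ} (ν : NodeIndex p k m) : ‖node ν‖ ≤ 1 := by
  refine norm_add_le_of_ultra (padic_norm_natCast_le_one _) ?_
  rw [norm_mul]
  exact mul_le_one₀ (padic_norm_pow_le_one m) (norm_nonneg _) (padic_norm_natCast_le_one _)

theorem nodeBasis_of_one_lt {m : ℕ} (ν : NodeIndex p k m) {x : ℚ_[p]} (hx : 1 < ‖x‖) :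
    nodeBasis ν x = 0 := by
  refine ballPoly_of_notMem _ fun h => hx.not_ge ?_
  have := norm_add_le_of_ultra (h.trans (padic_norm_pow_le_one m))
    (padic_norm_natCast_le_one (p := p) ν.1)
  simpa using this

/-- The balls of level `m` are disjoint, so only the one containing `x` contributes, and Lagrange
interpolation on that ball remains. -/
theorem sum_nodeBasis_smul {E : Type*} [AddCommGroup E] [Module ℚ_[p] E] {m : ℕ} {x : ℚ_[p]}
    {a : Fin (p ^ m)} (ha : ‖x - ((a : ℕ) : ℚ_[p])‖ ≤ ‖(p : ℚ_[p]) ^ m‖) (F : ℚ_[p] → E) :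
    ∑ ν : NodeIndex p k m, nodeBasis ν x • F (node ν) =
      ∑ j : Fin (k + 1), (lagrangeNat p j).eval ((x - ((a : ℕ) : ℚ_[p])) / (p : ℚ_[p]) ^ m) •
        F (node (a, j)) := by
  rw [Fintype.sum_prod_type, Finset.sum_eq_single a]
  · exact Finset.sum_congr rfl fun j _ => by rw [nodeBasis, ballPoly_of_mem _ ha]
  · intro a' _ ha'
    refine Finset.sum_eq_zero fun j _ => ?_
    rw [nodeBasis, ballPoly_of_notMem, zero_smul]
    intro h
    refine ha' ((norm_natCast_sub_le_iff a' a).1 ?_)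
    simpa using norm_sub_le_of_ultra ha h
  · simp

theorem injective_natCast_fin (k : ℕ) :
    Function.Injective fun i : Fin (k + 1) => ((i : ℕ) : ℚ_[p]) :=
  fun _ _ h => Fin.ext (Nat.cast_injective h)

/-- Interpolation reproduces the functions which are polynomials of degree `≤ k` on each ball. -/
theorem sum_nodeBasis_mul_eq {m : ℕ} (ψ : ℚ_[p] → ℚ_[p]) (h0 : ∀ x, 1 < ‖x‖ → ψ x = 0)
    (h : ∀ a : Fin (p ^ m), ∃ q : Polynomial ℚ_[p], q.natDegree ≤ k ∧
      ∀ x, ‖x - ((a : ℕ) : ℚ_[p])‖ ≤ ‖(p : ℚ_[p]) ^ m‖ →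
        ψ x = q.eval ((x - ((a : ℕ) : ℚ_[p])) / (p : ℚ_[p]) ^ m)) (x : ℚ_[p]) :
    ∑ ν : NodeIndex p k m, nodeBasis ν x * ψ (node ν) = ψ x := by
  by_cases hx : ‖x‖ ≤ 1
  · obtain ⟨a, ha⟩ := exists_norm_sub_natCast_le m hx
    obtain ⟨q, hq, hqe⟩ := h a
    have hq' : q.degree < (Finset.univ : Finset (Fin (k + 1))).card := by
      rw [Finset.card_fin]
      exact Polynomial.degree_lt_iff_coeff_zero _ _ |>.2 fun d hd =>
        Polynomial.coeff_eq_zero_of_natDegree_lt (by omega)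
    refine (sum_nodeBasis_smul ha ψ).trans ?_
    rw [hqe x ha, Lagrange.eq_interpolate (injective_natCast_fin k).injOn hq',
      Lagrange.interpolate_apply, Polynomial.eval_finsetSum]
    refine Finset.sum_congr rfl fun j _ => ?_
    have hj : ψ (node (a, j)) = q.eval ((j : ℕ) : ℚ_[p]) := by
      rw [hqe, node, add_sub_cancel_left, mul_div_cancel_left₀ _ (padic_pow_ne_zero m)]
      exact norm_add_pow_mul_sub_le m (padic_norm_natCast_le_one _) (by simp)
    rw [hj, Polynomial.eval_mul, Polynomial.eval_C, smul_eq_mul, mul_comm]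
    rfl
  · push Not at hx
    rw [h0 x hx]
    exact Finset.sum_eq_zero fun ν _ => by rw [nodeBasis_of_one_lt ν hx, zero_mul]

theorem sum_nodeBasis_eq_one {m : ℕ} {x : ℚ_[p]} (hx : ‖x‖ ≤ 1) :
    ∑ ν : NodeIndex p k m, nodeBasis ν x = 1 := by
  have := sum_nodeBasis_mul_eq (k := k) (m := m) (fun x : ℚ_[p] => if ‖x‖ ≤ 1 then 1 else 0)
    (fun x hx => if_neg hx.not_ge) (fun a => ⟨1, by simp, fun x hx => ?_⟩) x
  · simpa [norm_node_le_one, hx] using this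
  · have := norm_add_le_of_ultra (hx.trans (padic_norm_pow_le_one m))
      (padic_norm_natCast_le_one (p := p) a)
    rw [sub_add_cancel] at this
    simp [this]

/-- A ball of level `m` lies inside or outside the coarser ball of `μ`, so `nodeBasis μ` is on it a
polynomial of degree at most `k` or zero. -/
theorem sum_nodeBasis_mul_nodeBasis {m m' : ℕ} (hm : m' ≤ m) (μ : NodeIndex p k m') (x : ℚ_[p]) :
    ∑ ν : NodeIndex p k m, nodeBasis ν x * nodeBasis μ (node ν) = nodeBasis μ x := by
  refine sum_nodeBasis_mul_eq _ (fun x => nodeBasis_of_one_lt μ) (fun a => ?_) x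
  by_cases ha : ‖((a : ℕ) : ℚ_[p]) - ((μ.1 : ℕ) : ℚ_[p])‖ ≤ ‖(p : ℚ_[p]) ^ m'‖
  · refine ⟨(lagrangeNat p μ.2).comp
      (Polynomial.C ((p : ℚ_[p]) ^ m / (p : ℚ_[p]) ^ m') * Polynomial.X + Polynomial.C
        ((((a : ℕ) : ℚ_[p]) - ((μ.1 : ℕ) : ℚ_[p])) / (p : ℚ_[p]) ^ m')), ?_, fun x hx => ?_⟩
    · refine Polynomial.natDegree_comp_le.trans ?_
      have h1 : (lagrangeNat p μ.2).natDegree = k := by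
        refine Polynomial.natDegree_eq_of_degree_eq_some ?_
        rw [lagrangeNat, Lagrange.degree_basis (injective_natCast_fin k).injOn (Finset.mem_univ _)]
        simp
      rw [h1]
      exact (Nat.mul_le_mul_left k (Polynomial.natDegree_linear_le)).trans (mul_one k).le
    · have hxμ : ‖x - ((μ.1 : ℕ) : ℚ_[p])‖ ≤ ‖(p : ℚ_[p]) ^ m'‖ := by
        simpa using norm_add_le_of_ultra (hx.trans (padic_norm_pow_le_pow hm)) ha
      rw [nodeBasis, ballPoly_of_mem _ hxμ, Polynomial.eval_comp]
      congr 1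
      have h1 := padic_pow_ne_zero (p := p) m
      have h2 := padic_pow_ne_zero (p := p) m'
      simp only [Polynomial.eval_add, Polynomial.eval_mul, Polynomial.eval_C, Polynomial.eval_X]
      field_simp
      ring
  · refine ⟨0, by simp, fun x hx => ?_⟩
    rw [nodeBasis, ballPoly_of_notMem, Polynomial.eval_zero]
    intro h
    refine ha ?_
    simpa using norm_sub_le_of_ultra h (hx.trans (padic_norm_pow_le_pow hm))

-- After rescaling, the nodes in every ball are `0, …, k`, so one constant serves all levels. It is
-- taken as a scalar in order to act on `E`, and of norm at least 1 so that exponents may be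
-- enlarged.
variable (p k) in
theorem exists_norm_coeff_lagrangeNat_le :
    ∃ D : ℚ_[p], 1 ≤ ‖D‖ ∧ ∀ (j : Fin (k + 1)) (d : ℕ), ‖(lagrangeNat p j).coeff d‖ ≤ ‖D‖ := by
  obtain ⟨D, hD⟩ := NormedField.exists_lt_norm ℚ_[p]
    (1 + ∑ j : Fin (k + 1), ∑ d ∈ (lagrangeNat p j).support, ‖(lagrangeNat p j).coeff d‖)
  have hnn : ∀ j : Fin (k + 1), 0 ≤ ∑ d ∈ (lagrangeNat p j).support, ‖(lagrangeNat p j).coeff d‖ :=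
    fun j => Finset.sum_nonneg fun _ _ => norm_nonneg _
  have hsum := Finset.sum_nonneg fun j (_ : j ∈ Finset.univ) => hnn j
  refine ⟨D, by linarith, fun j d => ?_⟩
  by_cases hd : d ∈ (lagrangeNat p j).support
  · have h1 := Finset.single_le_sum (f := fun d => ‖(lagrangeNat p j).coeff d‖)
      (fun _ _ => norm_nonneg _) hd
    have h2 := Finset.single_le_sum (f := fun j : Fin (k + 1) =>
      ∑ d ∈ (lagrangeNat p j).support, ‖(lagrangeNat p j).coeff d‖) (fun j _ => hnn j)
      (Finset.mem_univ j)
    linarith [h1, h2]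
  · rw [Polynomial.notMem_support_iff.1 hd, norm_zero]
    exact norm_nonneg _

section Operator

variable {E : Type*} [AddCommGroup E] [Module ℚ_[p] E] {n : ℕ}

variable (k) in
/-- Piecewise polynomial interpolation of `f` on the boxes of radius `p ^ (-m)` in `ℤ_p ^ n`. -/
noncomputable def interp (m : ℕ) (f : (Fin n → ℚ_[p]) → E) (x : Fin n → ℚ_[p]) : E :=
  ∑ ν : Fin n → NodeIndex p k m, (∏ i, nodeBasis (ν i) (x i)) • f fun i => node (ν i)

theorem interp_interp {m m' : ℕ} (hm : m' ≤ m) (f : (Fin n → ℚ_[p]) → E) :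
    interp k m (interp k m' f) = interp k m' f := by
  funext x
  simp only [interp, Finset.smul_sum, smul_smul]
  rw [Finset.sum_comm]
  refine Finset.sum_congr rfl fun μ _ => ?_
  rw [← Finset.sum_smul]
  congr 1
  rw [Finset.prod_congr rfl fun i _ => (sum_nodeBasis_mul_nodeBasis hm (μ i) (x i)).symm,
    Fintype.prod_sum]
  exact Finset.sum_congr rfl fun ν _ => Finset.prod_mul_distrib.symm

theorem interp_sub (m : ℕ) (f g : (Fin n → ℚ_[p]) → E) :
    interp k m (fun z => f z - g z) = fun z => interp k m f z - interp k m g z := by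
  funext x
  simp only [interp, smul_sub, Finset.sum_sub_distrib]

theorem diffQuot_interp (m : ℕ) (f : (Fin n → ℚ_[p]) → E) (β : Fin n → ℕ)
    (x : (i : Fin n) → Fin (β i + 1) → ℚ_[p]) :
    diffQuot (interp k m f) β x =
      ∑ ν : Fin n → NodeIndex p k m,
        (∏ i, divDiff (nodeBasis (ν i)) (x i)) • f fun i => node (ν i) :=
  diffQuot_sum_prod_smul _ _ β x

end Operator

end Interpolation

/-! ### Partial difference quotients in a single direction. -/

section Slot

variable {𝕜 : Type*} {n : ℕ}

/-- The point of `𝕜 ^ (n + k)` with entries `y` in the direction `i` and entry `z l` in each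
direction `l ≠ i`. -/
def slotPoint (i : Fin n) (k : ℕ) (z : Fin n → 𝕜) (y : Fin (k + 1) → 𝕜) :
    (l : Fin n) → Fin ((Pi.single i k : Fin n → ℕ) l + 1) → 𝕜 :=
  fun l j => if l = i then y (Fin.ofNat (k + 1) j) else z l

theorem slotPoint_apply_index (i : Fin n) (k : ℕ) (z : Fin n → 𝕜) (y : Fin (k + 1) → 𝕜)
    (J : (l : Fin n) → Fin ((Pi.single i k : Fin n → ℕ) l + 1)) :
    (fun l => slotPoint i k z y l (J l)) = Function.update z i (y (Fin.ofNat (k + 1) (J i))) := by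
  funext l
  by_cases h : l = i
  · subst h
    simp [slotPoint]
  · simp [slotPoint, h]

theorem fin_single_eq_of_ne {i l : Fin n} {k : ℕ} (h : l ≠ i)
    (j j' : Fin ((Pi.single i k : Fin n → ℕ) l + 1)) : j = j' := by
  have h1 := j.2
  have h2 := j'.2
  simp only [Pi.single_eq_of_ne h] at h1 h2
  exact Fin.ext (by omega)

theorem ofNat_single_injective (i : Fin n) (k : ℕ) :
    Function.Injective fun j : Fin ((Pi.single i k : Fin n → ℕ) i + 1) =>
      Fin.ofNat (k + 1) (j : ℕ) := by
  intro j j' h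
  have h1 := j.2
  have h2 := j'.2
  simp only [Pi.single_eq_same] at h1 h2
  have := congrArg Fin.val h
  simp only [Fin.ofNat] at this
  rw [Nat.mod_eq_of_lt h1, Nat.mod_eq_of_lt h2] at this
  exact Fin.ext this

/-- This turns the hypothesis $C^{ke_i}$ into a statement about divided differences along lines in
direction `i`. -/
theorem diffQuot_slotPoint {E : Type*} [Field 𝕜] [TopologicalSpace 𝕜] [AddCommGroup E] [Module 𝕜 E]
    (f : (Fin n → 𝕜) → E) (i : Fin n) (k : ℕ) (z : Fin n → 𝕜)
    (y : Fin (k + 1) → 𝕜) :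
    diffQuot f (Pi.single i k) (slotPoint i k z y) =
      divDiff (fun t => f (Function.update z i t)) y := by
  -- Every index away from `i` ranges over a single value, so a multi-index amounts to its entry at
  -- `i`. `Fin.ofNat` bridges the types, as `Pi.single i k i` is only propositionally `k`.
  let e : ((l : Fin n) → Fin ((Pi.single i k : Fin n → ℕ) l + 1)) → Fin (k + 1) :=
    fun J => Fin.ofNat (k + 1) (J i)
  have hsurj : ∀ c : Fin (k + 1), ∃ j : Fin ((Pi.single i k : Fin n → ℕ) i + 1),
      Fin.ofNat (k + 1) (j : ℕ) = c := fun c =>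
    ⟨⟨c, by simpa using Nat.lt_succ_iff.1 c.2⟩, Fin.ext (Nat.mod_eq_of_lt c.2)⟩
  have he : Function.Bijective e := by
    constructor
    · intro J J' h
      funext l
      by_cases hl : l = i
      · subst hl
        exact ofNat_single_injective l k h
      · exact fin_single_eq_of_ne hl _ _
    · intro c
      obtain ⟨j, hj⟩ := hsurj c
      refine ⟨fun l => if h : l = i then h ▸ j else 0, ?_⟩
      simpa [e] using hj
  refine Fintype.sum_bijective e he _ _ fun J => ?_
  rw [slotPoint_apply_index]
  congr 1
  rw [Fintype.prod_eq_single i, ddWeight]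
  · refine Finset.prod_bij (fun j _ => Fin.ofNat (k + 1) (j : ℕ)) (fun j hj => ?_)
      (fun j _ j' _ h => ofNat_single_injective i k h) (fun c hc => ?_) (fun j hj => ?_)
    · rw [Finset.mem_erase] at hj ⊢
      exact ⟨fun h => hj.1 (ofNat_single_injective i k h), Finset.mem_univ _⟩
    · obtain ⟨j, rfl⟩ := hsurj c
      refine ⟨j, Finset.mem_erase.2 ⟨?_, Finset.mem_univ _⟩, rfl⟩
      rintro rfl
      exact (Finset.mem_erase.1 hc).1 rfl
    · simp [slotPoint, e]
  · intro l hl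
    exact Finset.prod_eq_one fun j hj =>
      absurd (fin_single_eq_of_ne hl _ _) (Finset.mem_erase.1 hj).1

theorem slotPoint_mem_dqDomain {K : Set (Fin n → 𝕜)} {i : Fin n} {k : ℕ} {z : Fin n → 𝕜}
    {y : Fin (k + 1) → 𝕜} (h : ∀ j, Function.update z i (y j) ∈ K) :
    slotPoint i k z y ∈ dqDomain K (Pi.single i k) := fun J => by
  rw [slotPoint_apply_index]
  exact h _

theorem slotPoint_mem_dqDomainOff {K : Set (Fin n → 𝕜)} {i : Fin n} {k : ℕ} {z : Fin n → 𝕜}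
    {y : Fin (k + 1) → 𝕜} (h : ∀ j, Function.update z i (y j) ∈ K) (hy : Function.Injective y) :
    slotPoint i k z y ∈ dqDomainOff K (Pi.single i k) := by
  refine ⟨slotPoint_mem_dqDomain h, fun l j j' hj => ?_⟩
  by_cases hl : l = i
  · subst hl
    simp only [slotPoint, if_true]
    exact hy.ne fun h => hj (ofNat_single_injective l k h)
  · exact absurd (fin_single_eq_of_ne hl _ _) hj

theorem isCompact_dqDomain [Field 𝕜] [TopologicalSpace 𝕜] [T2Space 𝕜] {K : Set (Fin n → 𝕜)}
    (hK : IsCompact K) (β : Fin n → ℕ) : IsCompact (dqDomain K β) := by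
  have hc : IsCompact (Set.univ.pi fun i : Fin n => Set.univ.pi fun _ : Fin (β i + 1) =>
      (fun z : Fin n → 𝕜 => z i) '' K) :=
    isCompact_univ_pi fun i => isCompact_univ_pi fun _ => hK.image (continuous_apply i)
  refine hc.of_isClosed_subset ?_ fun x hx i _ j _ => ?_
  · simp only [dqDomain, Set.ofPred_forall]
    refine isClosed_iInter fun J => hK.isClosed.preimage ?_
    fun_prop
  -- Any multi-index with entry `j` at `i` exhibits `x i j` as a coordinate of a point of `K`.
  · exact ⟨_, hx (fun l => if h : l = i then h ▸ j else 0), by simp⟩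

end Slot

/-! ### Open lattices and the interpolation error in one direction. -/

section Lattice

variable {p : ℕ} [Fact p.Prime] {E : Type*} [AddCommGroup E] [Module ℚ_[p] E]

variable (p) in
/-- `S` is an open `ℤ_p`-submodule. -/
def IsOpenLattice [TopologicalSpace E] (S : AddSubgroup E) : Prop :=
  IsOpen (S : Set E) ∧ ∀ a : ℚ_[p], ‖a‖ ≤ 1 → ∀ x ∈ S, a • x ∈ S

theorem IsOpenLattice.smul_mem_of_norm_le [TopologicalSpace E] {S : AddSubgroup E}
    (hS : IsOpenLattice p S) {c d : ℚ_[p]} {e : E} (h : ‖c‖ ≤ ‖d‖) (hd : d • e ∈ S) :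
    c • e ∈ S := by
  by_cases h0 : d = 0
  · rw [h0, norm_zero, norm_le_zero_iff] at h
    rw [h, zero_smul]
    exact S.zero_mem
  · have : c • e = (c / d) • d • e := by rw [smul_smul, div_mul_cancel₀ _ h0]
    rw [this]
    refine hS.2 _ ?_ _ hd
    rw [norm_div]
    exact div_le_one_of_le₀ h (norm_nonneg _)

/-- Every open lattice contains a multiple of an open lattice. -/
theorem IsOpenLattice.exists_smul_mem [TopologicalSpace E] [ContinuousSMul ℚ_[p] E]
    {S : AddSubgroup E} (hS : IsOpenLattice p S) (c : ℚ_[p]) :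
    ∃ T : AddSubgroup E, IsOpenLattice p T ∧ ∀ e ∈ T, c • e ∈ S := by
  refine ⟨S.comap (DistribSMul.toAddMonoidHom E c), ⟨?_, fun a ha x hx => ?_⟩, fun e he => he⟩
  · exact hS.1.preimage (continuous_const_smul c)
  · have := hS.2 a ha _ hx
    change c • a • x ∈ S
    rw [smul_comm]
    exact this

theorem exists_norm_pow_lt {δ : ℝ} (hδ : 0 < δ) :
    ∃ m₀ : ℕ, ∀ m ≥ m₀, ‖(p : ℚ_[p]) ^ m‖ < δ := by
  obtain ⟨m₀, h⟩ := exists_pow_lt_of_lt_one hδ (Padic.norm_p_lt_one (p := p))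
  refine ⟨m₀, fun m hm => (padic_norm_pow_le_pow hm).trans_lt ?_⟩
  rwa [norm_pow]

theorem eval_lagrangeNat {k m : ℕ} (x a : ℚ_[p]) (t : Fin (k + 1) → ℚ_[p])
    (ht : ∀ j, t j = a + (p : ℚ_[p]) ^ m * ((j : ℕ) : ℚ_[p])) (j : Fin (k + 1)) :
    (lagrangeNat p j).eval ((x - a) / (p : ℚ_[p]) ^ m) =
      ∏ l ∈ Finset.univ.erase j, (x - t l) / (t j - t l) := by
  rw [lagrangeNat, Lagrange.basis, Polynomial.eval_prod]
  refine Finset.prod_congr rfl fun l hl => ?_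
  have hne : ((j : ℕ) : ℚ_[p]) - ((l : ℕ) : ℚ_[p]) ≠ 0 :=
    sub_ne_zero.2 fun h => (Finset.mem_erase.1 hl).1 (injective_natCast_fin k h).symm
  have hp := padic_pow_ne_zero (p := p) m
  rw [ht, ht, add_sub_add_left_eq_sub, ← mul_sub, Lagrange.basisDivisor, Polynomial.eval_mul,
    Polynomial.eval_C, Polynomial.eval_sub, Polynomial.eval_X, Polynomial.eval_C]
  field_simp
  ring

theorem sum_lagrange_at_node {k : ℕ} (F : ℚ_[p] → E) {t : Fin (k + 1) → ℚ_[p]}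
    (ht : Function.Injective t) (i : Fin (k + 1)) :
    ∑ j, (∏ l ∈ Finset.univ.erase j, (t i - t l) / (t j - t l)) • F (t j) = F (t i) := by
  rw [Fintype.sum_eq_single i, Finset.prod_eq_one, one_smul]
  · exact fun l hl => div_self (sub_ne_zero.2 (ht.ne (Finset.mem_erase.1 hl).1.symm))
  · intro j hj
    rw [Finset.prod_eq_zero (Finset.mem_erase.2 ⟨hj.symm, Finset.mem_univ i⟩) (by simp), zero_smul]

variable [UniformSpace E] [IsUniformAddGroup E] {n : ℕ}

/-- Heine–Cantor for `g` on the compact `dqDomain`; uniformity makes `m₀` independent of the base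
point `z`. -/
theorem exists_divDiff_sub_mem {K : Set (Fin n → ℚ_[p])} (hK : IsCompact K)
    (f : (Fin n → ℚ_[p]) → E) (i : Fin n) (k : ℕ)
    {g : ((l : Fin n) → Fin ((Pi.single i k : Fin n → ℕ) l + 1) → ℚ_[p]) → E}
    (hg : ContinuousOn g (dqDomain K (Pi.single i k)))
    (hgf : EqOn g (diffQuot f (Pi.single i k)) (dqDomainOff K (Pi.single i k)))
    {S : AddSubgroup E} (hS : IsOpen (S : Set E)) :
    ∃ m₀ : ℕ, ∀ m ≥ m₀, ∀ (z : Fin n → ℚ_[p]) (y y' : Fin (k + 1) → ℚ_[p]),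
      Function.Injective y → Function.Injective y' →
      (∀ j, Function.update z i (y j) ∈ K) → (∀ j, Function.update z i (y' j) ∈ K) →
      (∀ j, ‖y j - y' j‖ ≤ ‖(p : ℚ_[p]) ^ m‖) →
      divDiff (fun t => f (Function.update z i t)) y -
        divDiff (fun t => f (Function.update z i t)) y' ∈ S := by
  have huc := (isCompact_dqDomain hK (Pi.single i k)).uniformContinuousOn_of_continuous hg
  have hU : {q : E × E | q.2 - q.1 ∈ S} ∈ uniformity E := by
    rw [uniformity_eq_comap_nhds_zero]
    exact preimage_mem_comap (hS.mem_nhds S.zero_mem)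
  have h1 := mem_inf_principal.1 (huc hU)
  obtain ⟨δ, hδ, h2⟩ := Metric.mem_uniformity_dist.1 h1
  obtain ⟨m₀, hm₀⟩ := exists_norm_pow_lt (p := p) hδ
  refine ⟨m₀, fun m hm z y y' hy hy' hyK hyK' hyy => ?_⟩
  have hd : dist (slotPoint i k z y') (slotPoint i k z y) < δ := by
    refine lt_of_le_of_lt ?_ (hm₀ m hm)
    refine (dist_pi_le_iff (norm_nonneg _)).2 fun l => (dist_pi_le_iff (norm_nonneg _)).2 fun j => ?_
    rw [dist_comm, dist_eq_norm]
    by_cases hl : l = i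
    · simpa only [slotPoint, if_pos hl] using hyy _
    · simp [slotPoint, hl]
  have := h2 hd ⟨slotPoint_mem_dqDomain hyK', slotPoint_mem_dqDomain hyK⟩
  rwa [← diffQuot_slotPoint, ← diffQuot_slotPoint, ← hgf (slotPoint_mem_dqDomainOff hyK hy),
    ← hgf (slotPoint_mem_dqDomainOff hyK' hy')]

/-- The error of interpolation in one direction. -/
theorem exists_interp_direction_error_mem {K : Set (Fin n → ℚ_[p])} (hK : IsCompact K) {M : ℕ}
    (hKM : ∀ z ∈ K, ∀ z' : Fin n → ℚ_[p], (∀ l, ‖z l - z' l‖ ≤ ‖(p : ℚ_[p]) ^ M‖) → z' ∈ K)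
    (f : (Fin n → ℚ_[p]) → E) (i : Fin n) (k : ℕ)
    {g : ((l : Fin n) → Fin ((Pi.single i k : Fin n → ℕ) l + 1) → ℚ_[p]) → E}
    (hg : ContinuousOn g (dqDomain K (Pi.single i k)))
    (hgf : EqOn g (diffQuot f (Pi.single i k)) (dqDomainOff K (Pi.single i k)))
    {S : AddSubgroup E} (hS : IsOpenLattice p S) :
    ∃ m₀ : ℕ, ∀ m ≥ m₀, ∀ z : Fin n → ℚ_[p], ‖z i‖ ≤ 1 →
      ((p : ℚ_[p]) ^ (m * k))⁻¹ • (K.indicator f z - ∑ ν : NodeIndex p k m,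
        nodeBasis ν (z i) • K.indicator f (Function.update z i (node ν))) ∈ S := by
  obtain ⟨m₀, hm₀⟩ := exists_divDiff_sub_mem hK f i k hg hgf hS.1
  -- From level `M` on, `K` is a union of boxes of radius $p^{-m}$: the point `z` and all nodes used
  -- for it lie together in `K` or together outside.
  refine ⟨max m₀ M, fun m hm z hz => ?_⟩
  obtain ⟨a, ha⟩ := exists_norm_sub_natCast_le m hz
  rw [sum_nodeBasis_smul ha fun t => K.indicator f (Function.update z i t)]
  obtain ⟨t, ht⟩ : ∃ t : Fin (k + 1) → ℚ_[p], ∀ j, node (a, j) = t j := ⟨_, fun _ => rfl⟩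
  have ht' : ∀ j, t j = ((a : ℕ) : ℚ_[p]) + (p : ℚ_[p]) ^ m * ((j : ℕ) : ℚ_[p]) :=
    fun j => (ht j).symm
  have hta : ∀ j, ‖t j - ((a : ℕ) : ℚ_[p])‖ ≤ ‖(p : ℚ_[p]) ^ m‖ := fun j => by
    rw [ht']
    exact norm_add_pow_mul_sub_le m (padic_norm_natCast_le_one _) (by simp)
  have htx : ∀ j, ‖z i - t j‖ ≤ ‖(p : ℚ_[p]) ^ m‖ := fun j => by
    simpa using norm_sub_le_of_ultra ha (hta j)
  have htinj : Function.Injective t := fun j j' h => by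
    rw [ht', ht', add_right_inj] at h
    exact injective_natCast_fin k (mul_left_cancel₀ (padic_pow_ne_zero m) h)
  have hclose : ∀ (u u' : ℚ_[p]), ‖u - u'‖ ≤ ‖(p : ℚ_[p]) ^ m‖ →
      ∀ l, ‖Function.update z i u l - Function.update z i u' l‖ ≤ ‖(p : ℚ_[p]) ^ M‖ := by
    intro u u' h l
    by_cases hl : l = i
    · subst hl
      simpa using h.trans (padic_norm_pow_le_pow (le_of_max_le_right hm))
    · simp [hl]
  by_cases hzK : z ∈ K
  · have hmem : ∀ u, ‖z i - u‖ ≤ ‖(p : ℚ_[p]) ^ m‖ → Function.update z i u ∈ K := fun u hu =>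
      hKM z hzK _ (by simpa using hclose (z i) u hu)
    have hF : ∀ j, K.indicator f (Function.update z i (t j)) = f (Function.update z i (t j)) :=
      fun j => Set.indicator_of_mem (hmem _ (htx j)) f
    simp only [ht, hF, eval_lagrangeNat (z i) _ t ht']
    rw [Set.indicator_of_mem hzK]
    -- The error formula needs `z i` distinct from the nodes; at a node the error is zero.
    by_cases hx : ∃ j, z i = t j
    · obtain ⟨j, hj⟩ := hx
      rw [hj, sum_lagrange_at_node (fun u => f (Function.update z i u)) htinj, ← hj,
        Function.update_eq_self, sub_self, smul_zero]
      exact S.zero_mem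
    · push Not at hx
      have hcons : Function.Injective (Fin.cons (z i) t : Fin (k + 2) → ℚ_[p]) :=
        Fin.cons_injective_iff.2 ⟨fun ⟨j, hj⟩ => hx j hj.symm, htinj⟩
      have herr := sub_lagrange_eq (fun u => f (Function.update z i u)) (z i) t hcons
      simp only [Function.update_eq_self] at herr
      rw [herr, smul_smul]
      -- The product of `k` factors of norm at most $p^{-m}$ compensates the division by $p^{mk}$,
      -- leaving a scalar in the unit ball.
      refine hS.2 _ ?_ _ (hm₀ m (le_of_max_le_left hm) z _ t
        (hcons.comp Fin.succAbove_right_injective) htinj (fun j => hmem _ ?_)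
        (fun j => hmem _ (htx j)) fun j => ?_)
      · rw [norm_mul, norm_inv, norm_prod, inv_mul_le_one₀ (norm_pos_iff.2 (padic_pow_ne_zero _)),
          pow_mul, norm_pow]
        exact (Finset.prod_le_prod (fun _ _ => norm_nonneg _) fun l _ => htx _).trans (by simp)
      all_goals
        have hc : ∀ l, ‖z i - (Fin.cons (z i) t : Fin (k + 2) → ℚ_[p]) l‖ ≤ ‖(p : ℚ_[p]) ^ m‖ :=
          Fin.cases (by simp) (by simpa using htx)
      · exact hc _
      · simpa using norm_sub_le_of_ultra (htx j) (hc _)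
  · have hout : ∀ j, K.indicator f (Function.update z i (t j)) = 0 := fun j =>
      Set.indicator_of_notMem (fun h => hzK (by
        refine hKM _ h z fun l => ?_
        have := hclose (t j) (z i) (by rw [norm_sub_rev]; exact htx j) l
        rwa [Function.update_eq_self] at this)) f
    simp only [ht, hout, smul_zero, Finset.sum_const_zero, Set.indicator_of_notMem hzK, sub_self]
    exact S.zero_mem

end Lattice

/-! ### Convergence of the interpolants and of their difference quotients. -/

section Convergence

variable {p : ℕ} [Fact p.Prime] {k : ℕ}

theorem norm_nodeBasis_le {D : ℚ_[p]}
    (hD : ∀ (j : Fin (k + 1)) (d : ℕ), ‖(lagrangeNat p j).coeff d‖ ≤ ‖D‖) {m : ℕ}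
    (ν : NodeIndex p k m) (x : ℚ_[p]) : ‖nodeBasis ν x‖ ≤ ‖D‖ := by
  have := norm_divDiff_ballPoly_le ((ν.1 : ℕ) : ℚ_[p]) (padic_pow_ne_zero m) (lagrangeNat p ν.2)
    (hD ν.2) (b := 0) (y := fun _ => x) (fun i j _ => Subsingleton.elim (α := Fin 1) i j)
  simpa [divDiff_zero_index, nodeBasis] using this

variable {E : Type*} [AddCommGroup E] [Module ℚ_[p] E] {n : ℕ}

/-- Interpolation of `f` in the directions in `s` only, with the weights of all directions. -/
noncomputable def partialInterp {m : ℕ} (s : Finset (Fin n)) (f : (Fin n → ℚ_[p]) → E)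
    (x : Fin n → ℚ_[p]) : E :=
  ∑ ν : Fin n → NodeIndex p k m,
    (∏ i, nodeBasis (ν i) (x i)) • f fun i => if i ∈ s then node (ν i) else x i

theorem partialInterp_empty (m : ℕ) (f : (Fin n → ℚ_[p]) → E) {x : Fin n → ℚ_[p]}
    (hx : ∀ i, ‖x i‖ ≤ 1) : partialInterp (k := k) (m := m) ∅ f x = f x := by
  simp only [partialInterp, Finset.notMem_empty, if_false]
  rw [← Finset.sum_smul, ← Fintype.prod_sum fun i (ν : NodeIndex p k m) => nodeBasis ν (x i),
    Finset.prod_eq_one fun i _ => sum_nodeBasis_eq_one (hx i), one_smul]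

theorem partialInterp_univ (m : ℕ) (f : (Fin n → ℚ_[p]) → E) (x : Fin n → ℚ_[p]) :
    partialInterp (k := k) (m := m) Finset.univ f x = interp k m f x := by
  simp [partialInterp, interp]

/-- The weights in direction `i` sum to 1, so they can be summed out of the first term; what remains
are interpolation errors in direction `i` alone, at points mixing nodes and coordinates of `x`. -/
theorem partialInterp_sub_insert (m : ℕ) (f : (Fin n → ℚ_[p]) → E) {x : Fin n → ℚ_[p]}
    (hx : ∀ i, ‖x i‖ ≤ 1) {s : Finset (Fin n)} {i : Fin n} (hi : i ∉ s) :
    partialInterp (k := k) (m := m) s f x - partialInterp (k := k) (m := m) (insert i s) f x =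
      ∑ ν : {l // l ≠ i} → NodeIndex p k m, (∏ l : {l // l ≠ i}, nodeBasis (ν l) (x l)) •
        (f (fun l => if h : l = i then x i else if l ∈ s then node (ν ⟨l, h⟩) else x l) -
          ∑ μ : NodeIndex p k m, nodeBasis μ (x i) • f (Function.update
            (fun l => if h : l = i then x i else if l ∈ s then node (ν ⟨l, h⟩) else x l)
              i (node μ))) := by
  rw [partialInterp, partialInterp, ← Finset.sum_sub_distrib,
    ← (Equiv.funSplitAt i (NodeIndex p k m)).symm.sum_comp, Fintype.sum_prod_type_right]
  refine Finset.sum_congr rfl fun ν _ => ?_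
  set z : Fin n → ℚ_[p] :=
    fun l => if h : l = i then x i else if l ∈ s then node (ν ⟨l, h⟩) else x l with hz
  have hfz : f z = ∑ μ : NodeIndex p k m, nodeBasis μ (x i) • f z := by
    rw [← Finset.sum_smul, sum_nodeBasis_eq_one (hx i), one_smul]
  rw [hfz, ← Finset.sum_sub_distrib, Finset.smul_sum]
  refine Finset.sum_congr rfl fun μ _ => ?_
  rw [← smul_sub, ← smul_sub, smul_smul, Fintype.prod_eq_mul_prod_subtype_ne _ i, mul_comm]
  have h1 : ∀ l : {l // l ≠ i}, (Equiv.funSplitAt i (NodeIndex p k m)).symm (μ, ν) l = ν l :=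
    fun l => by simp [Equiv.funSplitAt, Equiv.piSplitAt, l.2]
  have h2 : (Equiv.funSplitAt i (NodeIndex p k m)).symm (μ, ν) i = μ := by
    simp [Equiv.funSplitAt, Equiv.piSplitAt]
  simp only [h1, h2]
  congr 3
  · funext l
    by_cases hl : l = i
    · subst hl
      simp [hz, hi]
    · have hν : (Equiv.funSplitAt i (NodeIndex p k m)).symm (μ, ν) l = ν ⟨l, hl⟩ := h1 ⟨l, hl⟩
      simp only [hz, dif_neg hl, hν]
  · funext l
    by_cases hl : l = i
    · subst hl
      simp [h2]
    · have hν : (Equiv.funSplitAt i (NodeIndex p k m)).symm (μ, ν) l = ν ⟨l, hl⟩ := h1 ⟨l, hl⟩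
      simp only [hz, Finset.mem_insert, hl, false_or, Function.update_of_ne hl, dif_neg, hν,
        not_false_eq_true]

theorem smul_sub_interp_mem [TopologicalSpace E] {D : ℚ_[p]} (hD1 : 1 ≤ ‖D‖)
    (hD : ∀ (j : Fin (k + 1)) (d : ℕ), ‖(lagrangeNat p j).coeff d‖ ≤ ‖D‖) (m : ℕ)
    (f : (Fin n → ℚ_[p]) → E) {S T : AddSubgroup E} (hS : IsOpenLattice p S)
    (hT : ∀ e ∈ T, D ^ n • e ∈ S) (c : ℚ_[p])
    (hf : ∀ (i : Fin n) (z : Fin n → ℚ_[p]), ‖z i‖ ≤ 1 → c • (f z - ∑ ν : NodeIndex p k m,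
        nodeBasis ν (z i) • f (Function.update z i (node ν))) ∈ T)
    {x : Fin n → ℚ_[p]} (hx : ∀ i, ‖x i‖ ≤ 1) : c • (f x - interp k m f x) ∈ S := by
  rw [← partialInterp_univ]
  -- The claim is proved for every set of directions already interpolated; each new one adds a
  -- combination of one-direction errors with weights bounded by `D ^ n`, which the choice of `T`
  -- absorbs.
  induction (Finset.univ : Finset (Fin n)) using Finset.induction_on with
  | empty =>
    rw [partialInterp_empty m f hx, sub_self, smul_zero]
    exact S.zero_mem
  | insert i s hi ih =>
    rw [← sub_add_sub_cancel _ (partialInterp (k := k) (m := m) s f x), smul_add]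
    refine S.add_mem ih ?_
    rw [partialInterp_sub_insert m f hx hi, Finset.smul_sum]
    refine S.sum_mem fun ν _ => ?_
    rw [smul_comm]
    have hW : ‖∏ l : {l // l ≠ i}, nodeBasis (ν l) (x l)‖ ≤ ‖D ^ n‖ := by
      rw [norm_prod, norm_pow]
      refine (Finset.prod_le_prod (fun _ _ => norm_nonneg _)
        fun l _ => norm_nodeBasis_le hD (ν l) (x l)).trans ?_
      rw [Finset.prod_const]
      refine pow_le_pow_right₀ hD1 ?_
      rw [Finset.card_univ]
      exact (Fintype.card_subtype_le _).trans (Fintype.card_fin n).le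
    refine hS.smul_mem_of_norm_le hW (hT _ ?_)
    have := hf i (fun l => if h : l = i then x i else if l ∈ s then node (ν ⟨l, h⟩) else x l)
      (by simpa using hx i)
    simpa only [dif_pos] using this

/-- The interpolants of `f` converge to `f` on `ℤ_p ^ n` with error `o(p ^ (-m k))`. -/
def InterpConverges [TopologicalSpace E] (k : ℕ) (f : (Fin n → ℚ_[p]) → E) : Prop :=
  ∀ S : AddSubgroup E, IsOpenLattice p S → ∃ m₀ : ℕ, ∀ m ≥ m₀, ∀ z : Fin n → ℚ_[p],
    (∀ i, ‖z i‖ ≤ 1) → ((p : ℚ_[p]) ^ (m * k))⁻¹ • (f z - interp k m f z) ∈ S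

theorem interpConverges_indicator [UniformSpace E] [IsUniformAddGroup E]
    [ContinuousSMul ℚ_[p] E] {K : Set (Fin n → ℚ_[p])} (hK : IsCompact K) {M : ℕ}
    (hKM : ∀ z ∈ K, ∀ z' : Fin n → ℚ_[p], (∀ l, ‖z l - z' l‖ ≤ ‖(p : ℚ_[p]) ^ M‖) → z' ∈ K)
    (f : (Fin n → ℚ_[p]) → E) (k : ℕ)
    (hf : ∀ i : Fin n, ∃ g : ((l : Fin n) → Fin ((Pi.single i k : Fin n → ℕ) l + 1) → ℚ_[p]) → E,
      ContinuousOn g (dqDomain K (Pi.single i k)) ∧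
      EqOn g (diffQuot f (Pi.single i k)) (dqDomainOff K (Pi.single i k))) :
    InterpConverges k (K.indicator f) := by
  intro S hS
  obtain ⟨D, hD1, hD⟩ := exists_norm_coeff_lagrangeNat_le p k
  obtain ⟨T, hTL, hT⟩ := hS.exists_smul_mem (D ^ n)
  choose g hg hgf using hf
  choose m₀ hm₀ using fun i => exists_interp_direction_error_mem hK hKM f i k (hg i) (hgf i) hTL
  refine ⟨Finset.univ.sup m₀, fun m hm z hz => smul_sub_interp_mem hD1 hD m _ hS hT _
    (fun i z hz => hm₀ i m ((Finset.le_sup (Finset.mem_univ i)).trans hm) z hz) hz⟩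

/-- The inverse inequality in each coordinate gives the exponent $|\beta|$, which may be raised to
`k` because $p^{-m}$ has norm at least 1. -/
theorem norm_prod_divDiff_nodeBasis_le {D : ℚ_[p]}
    (hD : ∀ (j : Fin (k + 1)) (d : ℕ), ‖(lagrangeNat p j).coeff d‖ ≤ ‖D‖) {m : ℕ}
    (ν : Fin n → NodeIndex p k m) {β : Fin n → ℕ} (hβ : ∑ i, β i ≤ k)
    {x : (i : Fin n) → Fin (β i + 1) → ℚ_[p]} (hx : ∀ i, Function.Injective (x i)) :
    ‖∏ i, divDiff (nodeBasis (ν i)) (x i)‖ ≤ ‖D ^ n * ((p : ℚ_[p]) ^ (m * k))⁻¹‖ := by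
  have h1 : 1 ≤ ‖((p : ℚ_[p]) ^ m)⁻¹‖ := by
    rw [norm_inv]
    exact (one_le_inv₀ (norm_pos_iff.2 (padic_pow_ne_zero m))).2 (padic_norm_pow_le_one m)
  have h2 : ((p : ℚ_[p]) ^ (m * k))⁻¹ = ((p : ℚ_[p]) ^ m)⁻¹ ^ k := by rw [pow_mul, inv_pow]
  rw [norm_prod]
  refine (Finset.prod_le_prod (fun _ _ => norm_nonneg _) fun i _ =>
    norm_divDiff_ballPoly_le ((ν i).1 : ℚ_[p]) (padic_pow_ne_zero m) (lagrangeNat p (ν i).2)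
      (hD _) (hx i)).trans ?_
  rw [Finset.prod_mul_distrib, Finset.prod_const, Finset.card_fin, Finset.prod_pow_eq_pow_sum,
    norm_mul, norm_pow, h2, norm_pow _ k]
  exact mul_le_mul_of_nonneg_left (pow_le_pow_right₀ h1 hβ) (by positivity)

theorem InterpConverges.diffQuot_sub_mem [TopologicalSpace E] [ContinuousSMul ℚ_[p] E]
    {f : (Fin n → ℚ_[p]) → E} (hf : InterpConverges k f) {β : Fin n → ℕ} (hβ : ∑ i, β i ≤ k)
    {S : AddSubgroup E} (hS : IsOpenLattice p S) :
    ∃ m₀ : ℕ, ∀ m ≥ m₀, ∀ x : (i : Fin n) → Fin (β i + 1) → ℚ_[p],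
      (∀ i, Function.Injective (x i)) →
        diffQuot (interp k (m + 1) f) β x - diffQuot (interp k m f) β x ∈ S := by
  obtain ⟨D, hD1, hD⟩ := exists_norm_coeff_lagrangeNat_le p k
  obtain ⟨T, hTL, hT⟩ := hS.exists_smul_mem (D ^ n * ((p : ℚ_[p]) ^ k)⁻¹)
  obtain ⟨m₀, hm₀⟩ := hf T hTL
  refine ⟨m₀, fun m hm x hx => ?_⟩
  -- The difference of consecutive interpolants is reproduced at level `m + 1`, so its quotients are
  -- combinations of its node values with bounded weights.
  have hg : interp k (m + 1) (fun z => interp k (m + 1) f z - interp k m f z) =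
      fun z => interp k (m + 1) f z - interp k m f z := by
    rw [interp_sub, interp_interp le_rfl, interp_interp (Nat.le_succ m)]
  rw [← diffQuot_sub, ← hg, diffQuot_interp]
  refine S.sum_mem fun ν _ => hS.smul_mem_of_norm_le (norm_prod_divDiff_nodeBasis_le hD ν hβ hx) ?_
  -- The weights belong to level `m + 1`, one of the errors to level `m`; the discrepancy is the
  -- fixed scalar $p^{-k}$, built into `T`.
  have hpow : D ^ n * ((p : ℚ_[p]) ^ ((m + 1) * k))⁻¹ =
      D ^ n * ((p : ℚ_[p]) ^ k)⁻¹ * ((p : ℚ_[p]) ^ (m * k))⁻¹ := by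
    rw [add_mul, one_mul, pow_add, mul_inv]
    ring
  rw [hpow, mul_smul]
  refine hT _ ?_
  have hz : ∀ i, ‖node (ν i)‖ ≤ 1 := fun i => norm_node_le_one (ν i)
  have h1 := hm₀ m hm _ hz
  have h2 := hm₀ (m + 1) (hm.trans (Nat.le_succ m)) _ hz
  have h3 : ‖((p : ℚ_[p]) ^ (m * k))⁻¹‖ ≤ ‖((p : ℚ_[p]) ^ ((m + 1) * k))⁻¹‖ := by
    rw [norm_inv, norm_inv]
    exact inv_anti₀ (norm_pos_iff.2 (padic_pow_ne_zero _))
      (padic_norm_pow_le_pow (Nat.mul_le_mul_right k (Nat.le_succ m)))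
  have := T.sub_mem h1 (hTL.smul_mem_of_norm_le h3 h2)
  rw [← smul_sub] at this
  simpa using this

theorem InterpConverges.tendsto [UniformSpace E] [IsUniformAddGroup E]
    (hconv : IsUltrametricLocallyConvex ℚ_[p] E)
    {f : (Fin n → ℚ_[p]) → E} (hf : InterpConverges k f) {z : Fin n → ℚ_[p]}
    (hz : ∀ i, ‖z i‖ ≤ 1) : Tendsto (fun m => interp k m f z) atTop (𝓝 (f z)) := by
  rw [← tendsto_sub_nhds_zero_iff, (show (𝓝 (0 : E)).HasBasis _ _ from hconv).tendsto_right_iff]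
  intro S hS
  obtain ⟨m₀, hm₀⟩ := hf S hS
  filter_upwards [eventually_ge_atTop m₀] with m hm
  have h1 : ‖(1 : ℚ_[p])‖ ≤ ‖((p : ℚ_[p]) ^ (m * k))⁻¹‖ := by
    rw [norm_one, norm_inv]
    exact (one_le_inv₀ (norm_pos_iff.2 (padic_pow_ne_zero _))).2 (padic_norm_pow_le_one _)
  have := IsOpenLattice.smul_mem_of_norm_le hS h1 (hm₀ m hm z hz)
  rw [one_smul] at this
  simpa using S.neg_mem this

/-- The difference quotients of order at most `k` of a function which is approximated by its
interpolants to order `k` extend continuously. -/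
theorem InterpConverges.exists_continuous_diffQuot [UniformSpace E] [IsUniformAddGroup E]
    [ContinuousSMul ℚ_[p] E] [T2Space E]
    (hconv : IsUltrametricLocallyConvex ℚ_[p] E) (hcomplete : IsSequentiallyComplete E)
    {f : (Fin n → ℚ_[p]) → E} (hf : InterpConverges k f) {β : Fin n → ℕ} (hβ : ∑ i, β i ≤ k) :
    ∃ G : ((i : Fin n) → Fin (β i + 1) → ℚ_[p]) → E, Continuous G ∧
      ∀ x, (∀ i, Function.Injective (x i)) → (∀ i j, ‖x i j‖ ≤ 1) → diffQuot f β x = G x := by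
  have hbasis := (show (𝓝 (0 : E)).HasBasis _ _ from hconv).uniformity_of_nhds_zero
  have hH : ∀ m, ∃ H : ((i : Fin n) → Fin (β i + 1) → ℚ_[p]) → E, Continuous H ∧
      ∀ x, (∀ i, Function.Injective (x i)) → H x = diffQuot (interp k m f) β x := fun m => by
    choose G hGc hG using fun (ν : NodeIndex p k m) (b : ℕ) =>
      exists_continuous_divDiff_ballPoly ((ν.1 : ℕ) : ℚ_[p]) (padic_pow_ne_zero m)
        (lagrangeNat p ν.2) b
    refine ⟨fun x => ∑ ν : Fin n → NodeIndex p k m,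
      (∏ i, G (ν i) (β i) (x i)) • f fun i => node (ν i), ?_, fun x hx => ?_⟩
    · refine continuous_finsetSum _ fun ν _ => Continuous.smul ?_ continuous_const
      exact continuous_finsetProd _ fun i _ => (hGc (ν i) (β i)).comp (continuous_apply i)
    · rw [diffQuot_interp]
      refine Finset.sum_congr rfl fun ν _ => ?_
      congr 1
      exact Finset.prod_congr rfl fun i _ => (hG (ν i) (β i) (x i) (hx i)).symm
  choose H hHc hH using hH
  -- Steps lying in a subgroup telescope without any summability. An open subgroup is closed, so the
  -- estimate passes from tuples of distinct entries to all tuples by density.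
  have hstep : ∀ S : AddSubgroup E, IsOpenLattice p S →
      ∃ m₀ : ℕ, ∀ m ≥ m₀, ∀ m' ≥ m, ∀ x, H m' x - H m x ∈ S := fun S hS => by
    obtain ⟨m₀, hm₀⟩ := hf.diffQuot_sub_mem hβ hS
    refine ⟨m₀, fun m hm m' hm' x => ?_⟩
    induction m', hm' using Nat.le_induction with
    | base => simp
    | succ l hl ih =>
      rw [← sub_add_sub_cancel _ (H l x)]
      refine S.add_mem ?_ ih
      have hcl : IsClosed {x | H (l + 1) x - H l x ∈ S} :=
        (S.isClosed_of_isOpen hS.1).preimage ((hHc _).sub (hHc _))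
      refine hcl.closure_subset_iff.2 (fun y hy => ?_) (dense_setOf_forall_injective β x)
      change H (l + 1) y - H l y ∈ S
      rw [hH _ y hy, hH _ y hy]
      exact hm₀ l (le_trans hm hl) y hy
  have hlim : ∀ x, ∃ e, Tendsto (fun m => H m x) atTop (𝓝 e) := fun x => by
    refine hcomplete _ (hbasis.cauchySeq_iff'.2 fun S hS => ?_)
    obtain ⟨m₀, hm₀⟩ := hstep S hS
    refine ⟨m₀, fun m hm => ?_⟩
    simpa using S.neg_mem (hm₀ m₀ le_rfl m hm x)
  choose G hG using hlim
  refine ⟨G, ?_, fun x hx hx1 => ?_⟩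
  · have hunif : TendstoUniformly H G atTop := fun u hu => by
      obtain ⟨S, hS, hSu⟩ := hbasis.mem_iff.1 hu
      obtain ⟨m₀, hm₀⟩ := hstep S hS
      filter_upwards [eventually_ge_atTop m₀] with m hm x
      refine hSu ?_
      have hcl : IsClosed (S : Set E) := S.isClosed_of_isOpen hS.1
      refine hcl.mem_of_tendsto (tendsto_const_nhds.sub (hG x)) ?_
      filter_upwards [eventually_ge_atTop m] with m' hm'
      simpa using S.neg_mem (hm₀ m hm m' hm' x)
    exact hunif.continuous (Frequently.of_forall hHc)
  -- At distinct entries the quotient is a finite combination of values, so pointwise convergence of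
  -- the interpolants identifies the limit.
  · refine tendsto_nhds_unique ?_ (hG x)
    simp only [hH _ x hx, diffQuot]
    exact tendsto_finsetSum _ fun J _ => (hf.tendsto hconv fun i => hx1 i _).const_smul _

end Convergence

/-! ### Localisation near a point of $V^{<\beta>}$. -/

section LocalExtension

variable {p : ℕ} [Fact p.Prime] {n : ℕ}

theorem dqDomain_mono {𝕜 : Type*} [Field 𝕜] [TopologicalSpace 𝕜] {K V : Set (Fin n → 𝕜)}
    (h : K ⊆ V) (β : Fin n → ℕ) : dqDomain K β ⊆ dqDomain V β :=
  fun _ hx J => h (hx J)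

theorem dqDomainOff_mono {𝕜 : Type*} [Field 𝕜] [TopologicalSpace 𝕜] {K V : Set (Fin n → 𝕜)}
    (h : K ⊆ V) (β : Fin n → ℕ) : dqDomainOff K β ⊆ dqDomainOff V β :=
  fun _ hx => ⟨dqDomain_mono h β hx.1, hx.2⟩

theorem isOpen_dqDomain {𝕜 : Type*} [Field 𝕜] [TopologicalSpace 𝕜] {V : Set (Fin n → 𝕜)}
    (hV : IsOpen V) (β : Fin n → ℕ) : IsOpen (dqDomain V β) := by
  simp only [dqDomain, Set.ofPred_forall]
  refine isOpen_iInter_of_finite fun J => hV.preimage ?_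
  fun_prop

theorem dqDomain_subset_closure {V : Set (Fin n → ℚ_[p])} (hV : IsOpen V) (β : Fin n → ℕ) :
    dqDomain V β ⊆ closure (dqDomainOff V β) := fun x hx => by
  refine mem_closure_of_tendsto (tendsto_add_mul x) ?_
  filter_upwards [(tendsto_add_mul x).eventually ((isOpen_dqDomain hV β).mem_nhds hx),
    eventually_all.2 fun i => eventually_injective_add_mul (x i)] with t h1 h2
  exact ⟨h1, fun i j j' hj h => hj (h2 i h)⟩

/-- The union of the boxes of radius `p ^ (-M)` around the points of `V` with entries in `x`. -/
def boxes {β : Fin n → ℕ} (M : ℕ) (x : (i : Fin n) → Fin (β i + 1) → ℚ_[p]) :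
    Set (Fin n → ℚ_[p]) :=
  {z | ∀ i, ∃ j, ‖z i - x i j‖ ≤ ‖(p : ℚ_[p]) ^ M‖}

theorem isCompact_boxes {β : Fin n → ℕ} (M : ℕ) (x : (i : Fin n) → Fin (β i + 1) → ℚ_[p]) :
    IsCompact (boxes M x) := by
  have h : boxes M x = Set.univ.pi fun i => ⋃ j, Metric.closedBall (x i j) ‖(p : ℚ_[p]) ^ M‖ := by
    ext z
    simp [boxes, Set.mem_pi, dist_eq_norm]
  rw [h]
  exact isCompact_univ_pi fun i => isCompact_iUnion fun j => isCompact_closedBall _ _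

theorem exists_boxes_subset {V : Set (Fin n → ℚ_[p])} (hV : IsOpen V) {β : Fin n → ℕ}
    {x : (i : Fin n) → Fin (β i + 1) → ℚ_[p]} (hx : x ∈ dqDomain V β) :
    ∃ M, boxes M x ⊆ V := by
  have key : ∀ J : (i : Fin n) → Fin (β i + 1), ∀ᶠ M : ℕ in atTop, ∀ z : Fin n → ℚ_[p],
      (∀ i, ‖z i - x i (J i)‖ ≤ ‖(p : ℚ_[p]) ^ M‖) → z ∈ V := fun J => by
    obtain ⟨ε, hε, hb⟩ := Metric.isOpen_iff.1 hV _ (hx J)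
    obtain ⟨m₀, hm₀⟩ := exists_norm_pow_lt (p := p) hε
    filter_upwards [eventually_ge_atTop m₀] with M hM z hz
    refine hb (Metric.mem_ball.2 (((dist_pi_le_iff (norm_nonneg _)).2 fun i => ?_).trans_lt
      (hm₀ M hM)))
    rw [dist_eq_norm]
    exact hz i
  obtain ⟨M, hM⟩ := (eventually_all.2 key).exists
  refine ⟨M, fun z hz => ?_⟩
  choose J hJ using hz
  exact hM J z hJ

/-- Entries of `x` may be far apart, so a single box does not suffice; `boxes M x` surrounds all the
finitely many corner points of `x` and is compact. For `y` near `x` the corners of `y` stay in it,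
so extending `f` by zero leaves the quotient unchanged. -/
theorem exists_continuous_eventuallyEq_diffQuot {E : Type*} [AddCommGroup E] [Module ℚ_[p] E]
    [UniformSpace E] [IsUniformAddGroup E] [ContinuousSMul ℚ_[p] E] [T2Space E]
    (hconv : IsUltrametricLocallyConvex ℚ_[p] E) (hcomplete : IsSequentiallyComplete E)
    {V : Set (Fin n → ℚ_[p])} (hV : IsOpen V) (hV1 : ∀ z ∈ V, ∀ i, ‖z i‖ ≤ 1)
    {f : (Fin n → ℚ_[p]) → E} {k : ℕ}
    (hf : ∀ i : Fin n, IsCAlphaOnCartesian (Pi.single i k) f V)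
    {β : Fin n → ℕ} (hβ : ∑ i, β i ≤ k) {x : (i : Fin n) → Fin (β i + 1) → ℚ_[p]}
    (hx : x ∈ dqDomain V β) :
    ∃ G : ((i : Fin n) → Fin (β i + 1) → ℚ_[p]) → E, Continuous G ∧
      ∀ᶠ y in 𝓝 x, y ∈ dqDomainOff V β → G y = diffQuot f β y := by
  obtain ⟨M, hMV⟩ := exists_boxes_subset hV hx
  have hsat : ∀ z ∈ boxes M x, ∀ z' : Fin n → ℚ_[p],
      (∀ l, ‖z l - z' l‖ ≤ ‖(p : ℚ_[p]) ^ M‖) → z' ∈ boxes M x := fun z hz z' h i => by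
    obtain ⟨j, hj⟩ := hz i
    exact ⟨j, by simpa using norm_sub_le_of_ultra hj (h i)⟩
  have hconvg : InterpConverges k ((boxes M x).indicator f) :=
    interpConverges_indicator (isCompact_boxes M x) hsat f k fun i => by
      obtain ⟨g, hg, hgf⟩ := hf i _ le_rfl
      exact ⟨g, hg.mono (dqDomain_mono hMV _),
        hgf.mono (dqDomainOff_mono hMV _)⟩
  obtain ⟨G, hGc, hG⟩ := hconvg.exists_continuous_diffQuot hconv hcomplete hβ
  refine ⟨G, hGc, ?_⟩
  have hnear : ∀ᶠ y in 𝓝 x, ∀ i j, ‖y i j - x i j‖ ≤ ‖(p : ℚ_[p]) ^ M‖ := by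
    refine eventually_all.2 fun i => eventually_all.2 fun j => ?_
    have hc : Continuous fun y : (i : Fin n) → Fin (β i + 1) → ℚ_[p] => y i j - x i j := by fun_prop
    have hx0 : ‖x i j - x i j‖ < ‖(p : ℚ_[p]) ^ M‖ := by
      rw [sub_self, norm_zero]
      exact norm_pos_iff.2 (padic_pow_ne_zero M)
    filter_upwards [hc.norm.continuousAt.eventually_lt continuousAt_const hx0] with y hy
    exact hy.le
  filter_upwards [hnear] with y hy hyV
  rw [← hG y (fun i j j' h => by_contra fun hj => hyV.2 i j j' hj h) fun i j => ?_]
  · refine Finset.sum_congr rfl fun J _ => ?_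
    rw [Set.indicator_of_mem]
    exact fun i => ⟨J i, hy i (J i)⟩
  · simpa using hV1 _ (hyV.1 fun l => if h : l = i then h ▸ j else 0) i

end LocalExtension

theorem mainTheorem8 (p : ℕ) [Fact p.Prime] (n : ℕ) (hn : 1 ≤ n)
    (E : Type*) [AddCommGroup E] [Module ℚ_[p] E] [UniformSpace E] [IsUniformAddGroup E]
    [ContinuousSMul ℚ_[p] E] [T2Space E]
    (hconv : IsUltrametricLocallyConvex ℚ_[p] E) (hcomplete : IsSequentiallyComplete E)
    (U : Set (Fin n → ℚ_[p]))
    (hU : ∃ W : Set (Fin n → ℚ_[p]), IsOpen W ∧ U = W ∩ {x | ∀ i, ‖x i‖ ≤ 1})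
    (f : (Fin n → ℚ_[p]) → E) (k : ℕ) :
    IsCROn k f U ↔ ∀ i : Fin n, IsCAlphaOn (Pi.single i k) f U := by
  -- The multi-index $ke_i$ has order exactly `k`, which settles the forward direction.
  refine ⟨fun h i => h _ (by simp), fun h α hα V hVc hVU β hβ => ?_⟩
  obtain ⟨W, hW, rfl⟩ := hU
  obtain ⟨W', hW', hVW⟩ := hVU
  have hball : IsOpen {x : Fin n → ℚ_[p] | ∀ i, ‖x i‖ ≤ 1} := by
    simp only [Set.ofPred_forall]
    refine isOpen_iInter_of_finite fun i => ?_
    have := (IsUltrametricDist.isOpen_closedBall (0 : ℚ_[p]) one_ne_zero).preimage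
      (continuous_apply (A := fun _ : Fin n => ℚ_[p]) i)
    simpa [Metric.closedBall, Set.preimage] using this
  -- As $\mathbb Z_p^n$ is open, relatively open sets are open in $\mathbb Q_p^n$, and every tuple
  -- over `V` is a limit of tuples with distinct entries.
  have hV : IsOpen V := hVW ▸ (hW.inter hball).inter hW'
  have hV1 : ∀ z ∈ V, ∀ i, ‖z i‖ ≤ 1 := fun z hz => by
    rw [hVW] at hz
    exact hz.1.2
  have hβk : ∑ i, β i ≤ k := (Finset.sum_le_sum fun i _ => hβ i).trans hα
  have hlim : ∀ x ∈ dqDomain V β, ∃ e,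
      Tendsto (diffQuot f β) (𝓝[dqDomainOff V β] x) (𝓝 e) := fun x hx => by
    obtain ⟨G, hGc, hG⟩ := exists_continuous_eventuallyEq_diffQuot hconv hcomplete hV hV1
      (fun i => h i V hVc ⟨W', hW', hVW⟩) hβk hx
    refine ⟨G x, ((hGc.tendsto x).mono_left nhdsWithin_le_nhds).congr' ?_⟩
    filter_upwards [nhdsWithin_le_nhds hG, self_mem_nhdsWithin] with y hy hyV
    exact hy hyV
  -- The local extensions need no gluing: they show that limits exist at every point of
  -- $V^{<\beta>}$, and extension by limits is continuous since `E` is regular.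
  refine ⟨extendFrom (dqDomainOff V β) (diffQuot f β),
    continuousOn_extendFrom (dqDomain_subset_closure hV β) hlim, fun x hx => ?_⟩
  obtain ⟨e, he⟩ := hlim x hx.1
  rw [extendFrom_eq (subset_closure hx) he]
  exact tendsto_nhds_unique (he.mono_left (pure_le_nhdsWithin hx)) (tendsto_pure_nhds _ _)
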